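/- Let $N\ge 3$ and write $\mathbb{R}_+=(0,\infty)$, $B_R=\{x\in\mathbb{R}^N:|x|<R\}$, $2^*=\frac{2N}{N-2}$. Let $V:\mathbb{R}_+\to[0,\infty)$ and $K:\mathbb{R}_+\to(0,\infty)$ be continuous, and suppose there is $C>0$ with $V(r)\le C/r^2$ for all $r\in(0,1)$. Let $f:\mathbb{R}\to\mathbb{R}$ be the solution of $f'=\frac{1}{\sqrt{1+2f^2}}$ on $\mathbb{R}$, $f(0)=0$. Let $C^\infty_{c,r}(\mathbb{R}^N)$ be the space of radial functions in $C^\infty_c(\mathbb{R}^N)$, and let $D^{1,2}_r(\mathbb{R}^N)$ be its closure in the norm $\|u\|_{1,2}=(\int_{\mathbb{R}^N}|\nabla u|^2dx)^{1/2}$, realized as a space of functions in $L^{2^*}(\mathbb{R}^N)$ with weak gradient in $L^2$. Let $$X=\Big\{u\in D^{1,2}_r(\mathbb{R}^N):\int_{\mathbb{R}^N}V(|x|)u^2dx<\infty\Big\},\qquad E=\Big\{u\in D^{1,2}_r(\mathbb{R}^N):\int_{\mathbb{R}^N}V(|x|)f(u)^2dx<\infty\Big\},$$ and equip $E$ with the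 norm $\|u\|=\|u\|_{1,2}+\inf_{k>0}\frac1k\big[1+\int_{\mathbb{R}^N}V(|x|)f(ku)^2dx\big]$. Let $q_1,q_2>1$ be such that, for some $R_1,R_2>0$, $$\sup_{u\in E,\,\|u\|=1}\int_{B_{R_1}}K(|x|)|u|^{q_1}dx<\infty,\qquad \sup_{u\in E,\,\|u\|=1}\int_{\mathbb{R}^N\setminus B_{R_2}}K(|x|)|u|^{q_2}dx<\infty.$$ Let $g:\mathbb{R}\to\mathbb{R}$ be continuous, put $G(t)=\int_0^tg(s)\,ds$, and assume: - there is $\theta>2$ with $0\le 2\theta G(t)\le g(t)t$ for all $t\in\mathbb{R}$; - there is $t_0>0$ with $G(t_0)>0$; - there is $C>0$ with $|g(t)|\le C\min\{|t|^{q_1-1},|t|^{q_2-1}\}$ for all $t\in\mathbb{R}$. Let $u\in E$ be a critical point (that is, a point where the Fréchet derivative on $E$ is zero) of the functional $I:E\to\mathbb{R}$, $$I(u)=\frac12\int_{\mathbb{R}^N}|\nabla u|^2dx+\frac12\int_{\mathbb{R}^N}V(|x|)f(u)^2dx-\int_{\mathbb{R}^N}K(|x|)G(f(u))\,dx,$$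 and set $w=f(u)$. Then $w\in X$, and for every $h\in C^\infty_{c,r}(\mathbb{R}^N)$ the following four integrands are integrable and $$\int_{\mathbb{R}^N}(1+2w^2)\nabla w\cdot\nabla h\,dx+\int_{\mathbb{R}^N}2w|\nabla w|^2h\,dx+\int_{\mathbb{R}^N}V(|x|)wh\,dx=\int_{\mathbb{R}^N}K(|x|)g(w)h\,dx.$$ -/

import Mathlib

open MeasureTheory Filter Topology
open scoped ENNReal ContDiff

noncomputable section

namespace QuasilinearSchrodinger

/-! ### The change of variable -/

/-- The Cauchy problem `f' = 1 / √(1 + 2 f²)` on `ℝ`, `f 0 = 0`, has a solution. -/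
theorem exists_changeVar :
    ∃ f : ℝ → ℝ, f 0 = 0 ∧ ∀ t, HasDerivAt f (1 / √(1 + 2 * f t ^ 2)) t := by
  have hc : Continuous (fun s : ℝ => √(1 + 2 * s ^ 2)) := by fun_prop
  let F : ℝ → ℝ := fun s => ∫ x in (0 : ℝ)..s, √(1 + 2 * x ^ 2)
  have hF : ∀ s, HasDerivAt F (√(1 + 2 * s ^ 2)) s := fun s =>
    intervalIntegral.integral_hasDerivAt_right (hc.intervalIntegrable _ _)
      (hc.stronglyMeasurableAtFilter _ _) hc.continuousAt
  have h1 : ∀ s : ℝ, 1 ≤ √(1 + 2 * s ^ 2) := fun s => by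
    rw [Real.one_le_sqrt]; nlinarith [sq_nonneg s]
  have h0 : F 0 = 0 := intervalIntegral.integral_same
  have hFc : Continuous F := continuous_iff_continuousAt.2 fun s => (hF s).continuousAt
  have hmono : StrictMono F := strictMono_of_hasDerivAt_pos hF
    fun s => lt_of_lt_of_le one_pos (h1 s)
  have hmono' : Monotone (fun s => F s - s) :=
    monotone_of_hasDerivAt_nonneg (fun s => (hF s).sub (hasDerivAt_id s))
      fun s => by simpa using h1 s
  have htop : Tendsto F atTop atTop := by
    refine tendsto_atTop_mono' _ ?_ tendsto_id
    filter_upwards [eventually_ge_atTop 0] with s hs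
    have := hmono' hs
    simp only [h0, id] at this ⊢
    linarith
  have hbot : Tendsto F atBot atBot := by
    refine tendsto_atBot_mono' _ ?_ tendsto_id
    filter_upwards [eventually_le_atBot 0] with s hs
    have := hmono' hs
    simp only [h0, id] at this ⊢
    linarith
  have hsurj : Function.Surjective F := hFc.surjective htop hbot
  let e : ℝ ≃o ℝ := hmono.orderIsoOfSurjective F hsurj
  have he : ∀ s, e s = F s := fun s => rfl
  refine ⟨e.symm, ?_, fun t => ?_⟩
  · rw [e.symm_apply_eq, he, h0]
  · rw [one_div]
    refine HasDerivAt.of_local_left_inverse (f := F) (g := e.symm) e.symm.continuous.continuousAt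
      (hF (e.symm t)) (ne_of_gt (lt_of_lt_of_le one_pos (h1 _))) ?_
    exact Eventually.of_forall fun y => e.apply_symm_apply y

/-- The solution `f` of the Cauchy problem `f' = 1 / √(1 + 2 f²)`, `f 0 = 0`. -/
def changeVar : ℝ → ℝ := Classical.choose exists_changeVar

theorem changeVar_zero : changeVar 0 = 0 := (Classical.choose_spec exists_changeVar).1

theorem hasDerivAt_changeVar (t : ℝ) :
    HasDerivAt changeVar (1 / √(1 + 2 * changeVar t ^ 2)) t :=
  (Classical.choose_spec exists_changeVar).2 t

/-! ### Function spaces -/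

/-- Infinitely differentiable real functions on `ℝ^N` with compact support. -/
def IsTest {N : ℕ} (φ : EuclideanSpace ℝ (Fin N) → ℝ) : Prop :=
  ContDiff ℝ ∞ φ ∧ HasCompactSupport φ

/-- Radial test functions. -/
def IsRadialTest {N : ℕ} (φ : EuclideanSpace ℝ (Fin N) → ℝ) : Prop :=
  IsTest φ ∧ ∀ x y, ‖x‖ = ‖y‖ → φ x = φ y

/-- `G` is a weak (distributional) gradient of `u` on `ℝ^N`. -/
def IsWeakGradient {N : ℕ} (u : EuclideanSpace ℝ (Fin N) → ℝ)
    (G : EuclideanSpace ℝ (Fin N) → EuclideanSpace ℝ (Fin N)) : Prop :=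
  LocallyIntegrable u volume ∧ LocallyIntegrable G volume ∧
    ∀ φ : EuclideanSpace ℝ (Fin N) → ℝ, IsTest φ →
      ∫ x, u x • gradient φ x = -∫ x, φ x • G x

open Classical in
/-- The weak gradient `∇u` (unique almost everywhere when it exists; `0` if there is none). -/
def weakGradient {N : ℕ} (u : EuclideanSpace ℝ (Fin N) → ℝ) :
    EuclideanSpace ℝ (Fin N) → EuclideanSpace ℝ (Fin N) :=
  if h : ∃ G, IsWeakGradient u G then Classical.choose h else 0

/-- The critical Sobolev exponent `2* = 2N / (N - 2)`. -/
def sobolevExp (N : ℕ) : ℝ≥0∞ := ENNReal.ofReal (2 * (N : ℝ) / ((N : ℝ) - 2))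

/-- The norm `(∫ |∇u|²)^(1/2)`. -/
def normD {N : ℕ} (u : EuclideanSpace ℝ (Fin N) → ℝ) : ℝ :=
  √(∫ x, ‖weakGradient u x‖ ^ 2)

/-- Membership in `D_r^{1,2}(ℝ^N)`, `N ≥ 3`: the closure of the radial test functions in the norm
`(∫ |∇u|²)^(1/2)`. By the Sobolev inequality a sequence of test functions that is Cauchy in this
norm converges in `L^{2*}`, so the closure consists of the functions `u ∈ L^{2*}` with weak gradient
in `L²` for which some radial test functions `φ n` satisfy `∇(φ n) → ∇u` in `L²` and
`φ n → u` in `L^{2*}`. -/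
def MemD {N : ℕ} (u : EuclideanSpace ℝ (Fin N) → ℝ) : Prop :=
  MemLp u (sobolevExp N) volume ∧
    ∃ G : EuclideanSpace ℝ (Fin N) → EuclideanSpace ℝ (Fin N),
      IsWeakGradient u G ∧ MemLp G 2 volume ∧
      ∃ φ : ℕ → EuclideanSpace ℝ (Fin N) → ℝ, (∀ n, IsRadialTest (φ n)) ∧
        Tendsto (fun n => eLpNorm (fun x => φ n x - u x) (sobolevExp N) volume) atTop (𝓝 0) ∧
        Tendsto (fun n => eLpNorm (fun x => gradient (φ n) x - G x) 2 volume) atTop (𝓝 0)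

/-- Membership in `X`: `u ∈ D_r^{1,2}` and `∫ V(|x|) u² < ∞`. -/
def MemX {N : ℕ} (V : ℝ → ℝ) (u : EuclideanSpace ℝ (Fin N) → ℝ) : Prop :=
  MemD u ∧ Integrable (fun x => V ‖x‖ * u x ^ 2) volume

/-- Membership in `E`: `u ∈ D_r^{1,2}` and `∫ V(|x|) f(u)² < ∞`. -/
def MemE {N : ℕ} (V : ℝ → ℝ) (u : EuclideanSpace ℝ (Fin N) → ℝ) : Prop :=
  MemD u ∧ Integrable (fun x => V ‖x‖ * changeVar (u x) ^ 2) volume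

/-- The Orlicz norm `inf_{k > 0} (1/k) [1 + ∫ V(|x|) f(k u)²]`. -/
def normO {N : ℕ} (V : ℝ → ℝ) (u : EuclideanSpace ℝ (Fin N) → ℝ) : ℝ :=
  ⨅ k : Set.Ioi (0 : ℝ), 1 / (k : ℝ) * (1 + ∫ x, V ‖x‖ * changeVar ((k : ℝ) * u x) ^ 2)

/-- The norm of `E`. -/
def normE {N : ℕ} (V : ℝ → ℝ) (u : EuclideanSpace ℝ (Fin N) → ℝ) : ℝ :=
  normD u + normO V u

/-! ### Hypotheses on the potentials and on the nonlinearity -/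

/-- Hypothesis `(H)` on the potentials; only their values on `(0, ∞)` matter. -/
structure HypH (V K : ℝ → ℝ) : Prop where
  V_cont : ContinuousOn V (Set.Ioi 0)
  K_cont : ContinuousOn K (Set.Ioi 0)
  V_nonneg : ∀ r, 0 < r → 0 ≤ V r
  K_pos : ∀ r, 0 < r → 0 < K r
  V_bound : ∃ C : ℝ, 0 < C ∧ ∀ r, 0 < r → r < 1 → V r ≤ C / r ^ 2

/-- `S_0(q, R)`, the supremum of `∫_{B_R} K(|x|) |u|^q` over the unit sphere of `E`. -/
def S0 (N : ℕ) (V K : ℝ → ℝ) (q R : ℝ) : ℝ≥0∞ :=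
  ⨆ (u : EuclideanSpace ℝ (Fin N) → ℝ) (_ : MemE V u ∧ normE V u = 1),
    ∫⁻ x in Metric.ball (0 : EuclideanSpace ℝ (Fin N)) R, ENNReal.ofReal (K ‖x‖ * |u x| ^ q)

/-- `S_∞(q, R)`, the supremum of `∫_{ℝ^N \ B_R} K(|x|) |u|^q` over the unit sphere of `E`. -/
def SInfty (N : ℕ) (V K : ℝ → ℝ) (q R : ℝ) : ℝ≥0∞ :=
  ⨆ (u : EuclideanSpace ℝ (Fin N) → ℝ) (_ : MemE V u ∧ normE V u = 1),
    ∫⁻ x in (Metric.ball (0 : EuclideanSpace ℝ (Fin N)) R)ᶜ, ENNReal.ofReal (K ‖x‖ * |u x| ^ q)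

/-- The condition `(S'_{q₁,q₂})`. -/
def HypS (N : ℕ) (V K : ℝ → ℝ) (q₁ q₂ : ℝ) : Prop :=
  ∃ R₁ R₂ : ℝ, 0 < R₁ ∧ 0 < R₂ ∧ S0 N V K q₁ R₁ < ⊤ ∧ SInfty N V K q₂ R₂ < ⊤

/-- The primitive `G(t) = ∫_0^t g`. -/
def primG (g : ℝ → ℝ) (t : ℝ) : ℝ := ∫ s in (0 : ℝ)..t, g s

/-- The hypotheses `(g₁)`, `(g₂)` and `(g_{q₁,q₂})` on the continuous nonlinearity `g`. -/
structure HypG (g : ℝ → ℝ) (q₁ q₂ : ℝ) : Prop where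
  cont : Continuous g
  g1 : ∃ θ : ℝ, 2 < θ ∧ ∀ t, 0 ≤ 2 * θ * primG g t ∧ 2 * θ * primG g t ≤ g t * t
  g2 : ∃ t₀ : ℝ, 0 < t₀ ∧ 0 < primG g t₀
  growth : ∃ C : ℝ, 0 < C ∧ ∀ t, |g t| ≤ C * min (|t| ^ (q₁ - 1)) (|t| ^ (q₂ - 1))

/-! ### The functional and its critical points -/

/-- The functional `I`. -/
def energy {N : ℕ} (V K g : ℝ → ℝ) (u : EuclideanSpace ℝ (Fin N) → ℝ) : ℝ :=
  1 / 2 * (∫ x, ‖weakGradient u x‖ ^ 2)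
    + 1 / 2 * (∫ x, V ‖x‖ * changeVar (u x) ^ 2)
    - ∫ x, K ‖x‖ * primG g (changeVar (u x))

/-- `u ∈ E` is a critical point of `I : E → ℝ`: the Fréchet derivative of `I` at `u`, with respect
to the norm of `E`, exists and is zero, that is, `I(u + h) - I(u) = o(‖h‖)` as `h → 0` in `E`. -/
def IsCriticalPoint {N : ℕ} (V K g : ℝ → ℝ) (u : EuclideanSpace ℝ (Fin N) → ℝ) : Prop :=
  MemE V u ∧ ∀ ε : ℝ, 0 < ε → ∃ δ : ℝ, 0 < δ ∧
    ∀ h : EuclideanSpace ℝ (Fin N) → ℝ, MemE V h → normE V h ≤ δ →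
      |energy V K g (fun x => u x + h x) - energy V K g u| ≤ ε * normE V h

end QuasilinearSchrodinger

end

noncomputable section

namespace QuasilinearSchrodinger

/-! ### The change of variable and its derivative -/

/-! Write `f` for `changeVar`. The equation for `w = f(u)` is the Euler equation of `I` at `u`,
tested in the direction `v = h / f'(u) = h √(1 + 2w²)`. Since `∇u = √(1 + 2w²) ∇w` and the
derivative of `√(1 + 2f²)` is `2f / (1 + 2f²)`, the product `∇u · ∇v` equals `(1 + 2w²) ∇w · ∇h + 2w
|∇w|² h`. In the other two terms the factor `f'(u)` produced by the chain rule cancels against `v`,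
leaving `V w h` and `K g(w) h`. Membership `w ∈ X` is easier: `f` is 1-Lipschitz with `f(0) = 0`, so
it preserves `D_r^{1,2}`, and `∫ V w²` is literally the integral in the definition of `E`.

The work is to show that `v` is an admissible direction and that `I` is differentiable along it. The
factor `√(1 + 2f²)` is unbounded but Lipschitz, so the chain rule `HasRadialGradient.mul_comp` gives
`v ∈ D_r^{1,2}`. Moreover `V v² = V h² + 2 h² V f(u)²`: the first term is integrable because `V ≤ C
/ r²` near the origin and `N ≥ 3`, the second because `u ∈ E`. This yields `v ∈ E` and also
dominates the derivative of the potential term.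

For the nonlinear term, homogeneity extends the two suprema from the unit sphere to all of `E`. They
control `K` times the minimum of the two powers near the origin and near infinity; on the annulus
between, elements of `D_r^{1,2}` are bounded, by a decay estimate for radial functions
(`integrable_mul_min`). The gradient term is a quadratic polynomial in `t`. Thus `t ↦ I(u + t v)` is
differentiable at `0`, and criticality together with homogeneity of the norm forces its derivative
to vanish (`IsCriticalPoint.euler`). -/

/-- The reciprocal `√(1 + 2 f²)` of the derivative of the change of variable. -/
def invDeriv (s : ℝ) : ℝ := √(1 + 2 * changeVar s ^ 2)

theorem one_le_invDeriv (s : ℝ) : 1 ≤ invDeriv s := by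
  unfold invDeriv
  rw [Real.one_le_sqrt]; nlinarith [sq_nonneg (changeVar s)]

theorem invDeriv_pos (s : ℝ) : 0 < invDeriv s := one_pos.trans_le (one_le_invDeriv s)

theorem invDeriv_sq (s : ℝ) : invDeriv s ^ 2 = 1 + 2 * changeVar s ^ 2 :=
  Real.sq_sqrt (by positivity)

theorem hasDerivAt_changeVar' (s : ℝ) : HasDerivAt changeVar (1 / invDeriv s) s :=
  hasDerivAt_changeVar s

theorem deriv_changeVar (s : ℝ) : deriv changeVar s = 1 / invDeriv s :=
  (hasDerivAt_changeVar' s).deriv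

theorem differentiable_changeVar : Differentiable ℝ changeVar :=
  fun s => (hasDerivAt_changeVar' s).differentiableAt

theorem continuous_changeVar : Continuous changeVar := differentiable_changeVar.continuous

/-- Bootstrapping in the differential equation: `f'` is a smooth function of `f`, so `C^n`
regularity of `f` improves to `C^(n+1)`. -/
theorem contDiff_changeVar : ContDiff ℝ ∞ changeVar := by
  refine contDiff_infty.2 fun n => ?_
  induction n with
  | zero => exact contDiff_zero.2 continuous_changeVar
  | succ n ih =>
    have : deriv changeVar = fun s => 1 / √(1 + 2 * changeVar s ^ 2) :=
      funext fun s => (hasDerivAt_changeVar s).deriv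
    push_cast
    refine contDiff_succ_iff_deriv.2 ⟨differentiable_changeVar, by simp, ?_⟩
    rw [this]
    have h0 : ∀ s, 1 + 2 * changeVar s ^ 2 ≠ 0 := fun s => by positivity
    refine contDiff_const.div (ContDiff.sqrt ?_ h0) fun s => ?_
    · exact contDiff_const.add (contDiff_const.mul (ih.pow 2))
    · exact (Real.sqrt_pos.2 (by positivity)).ne'

theorem contDiff_invDeriv : ContDiff ℝ ∞ invDeriv :=
  ContDiff.sqrt (contDiff_const.add (contDiff_const.mul (contDiff_changeVar.pow 2)))
    fun s => by positivity

theorem continuous_invDeriv : Continuous invDeriv := contDiff_invDeriv.continuous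

theorem hasDerivAt_invDeriv (s : ℝ) :
    HasDerivAt invDeriv (2 * changeVar s / invDeriv s ^ 2) s := by
  have h := (((hasDerivAt_changeVar' s).pow 2).const_mul 2).const_add 1
  have h2 := h.sqrt (by have := sq_nonneg (changeVar s); simp only [Pi.pow_apply]; positivity)
  refine h2.congr_deriv ?_
  change _ / (2 * invDeriv s) = _
  have := (invDeriv_pos s).ne'
  simp only [Nat.cast_ofNat, Nat.add_one_sub_one, pow_one]
  field_simp

theorem abs_deriv_changeVar_le (s : ℝ) : |deriv changeVar s| ≤ 1 := by
  rw [deriv_changeVar, abs_of_pos (one_div_pos.2 (invDeriv_pos s))]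
  exact (div_le_one (invDeriv_pos s)).2 (one_le_invDeriv s)

theorem abs_two_mul_changeVar_div_le (s : ℝ) : |2 * changeVar s / invDeriv s ^ 2| ≤ 1 := by
  rw [abs_div, abs_of_nonneg (sq_nonneg (invDeriv s)), div_le_one (pow_pos (invDeriv_pos s) 2),
    invDeriv_sq, abs_le]
  constructor <;> nlinarith [sq_nonneg (changeVar s - 1), sq_nonneg (changeVar s + 1)]

/-- Although `1 / f'` is unbounded, it is Lipschitz; this is what lets it be composed with elements
of `D_r^{1,2}`. -/
theorem abs_deriv_invDeriv_le (s : ℝ) : |deriv invDeriv s| ≤ 1 := by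
  rw [(hasDerivAt_invDeriv s).deriv]
  exact abs_two_mul_changeVar_div_le s

theorem abs_sub_le_of_abs_deriv_le {F : ℝ → ℝ} (hF : Differentiable ℝ F) {C : ℝ}
    (hC : ∀ s, |deriv F s| ≤ C) (a b : ℝ) : |F a - F b| ≤ C * |a - b| :=
  Convex.norm_image_sub_le_of_norm_deriv_le (s := Set.univ) (fun x _ => hF x)
    (fun x _ => hC x) convex_univ (Set.mem_univ b) (Set.mem_univ a)

theorem abs_changeVar_le (s : ℝ) : |changeVar s| ≤ |s| := by
  simpa [changeVar_zero] using
    abs_sub_le_of_abs_deriv_le differentiable_changeVar abs_deriv_changeVar_le s 0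

theorem strictMono_changeVar : StrictMono changeVar :=
  strictMono_of_hasDerivAt_pos hasDerivAt_changeVar' fun s => one_div_pos.2 (invDeriv_pos s)

theorem changeVar_sq_le_sq_mul {c : ℝ} (hc : 1 ≤ c) (s : ℝ) :
    changeVar s ^ 2 ≤ changeVar (c * s) ^ 2 := by
  rcases le_total 0 s with hs | hs
  · have h1 := strictMono_changeVar.monotone hs
    have h2 := strictMono_changeVar.monotone (show s ≤ c * s by nlinarith)
    rw [changeVar_zero] at h1
    nlinarith
  · have h1 := strictMono_changeVar.monotone hs
    have h2 := strictMono_changeVar.monotone (show c * s ≤ s by nlinarith)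
    rw [changeVar_zero] at h1
    nlinarith

/-- The slope `f'` decreases as `|f|` grows, so `c f(t) - f(c t)` is nondecreasing in `t`; it
vanishes at `0`. This doubling-type bound makes `E` stable under dilation. -/
theorem changeVar_mul_sq_le_of_one_le {c : ℝ} (hc : 1 ≤ c) (s : ℝ) :
    changeVar (c * s) ^ 2 ≤ c ^ 2 * changeVar s ^ 2 := by
  have hd : ∀ t, HasDerivAt (fun t => c * changeVar t - changeVar (c * t))
      (c * (1 / invDeriv t) - 1 / invDeriv (c * t) * (c * 1)) t := fun t =>
    ((hasDerivAt_changeVar' t).const_mul c).sub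
      ((hasDerivAt_changeVar' (c * t)).comp t ((hasDerivAt_id t).const_mul c))
  have hmono : Monotone fun t => c * changeVar t - changeVar (c * t) := by
    refine monotone_of_hasDerivAt_nonneg hd fun t => ?_
    have h1 : invDeriv t ≤ invDeriv (c * t) :=
      Real.sqrt_le_sqrt (by linarith [changeVar_sq_le_sq_mul hc t])
    have h2 := one_div_le_one_div_of_le (invDeriv_pos t) h1
    have : 0 ≤ c * (1 / invDeriv t - 1 / invDeriv (c * t)) :=
      mul_nonneg (by linarith) (by linarith)
    simp only [Pi.zero_apply]
    linarith
  rw [← mul_pow]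
  rcases le_total 0 s with hs | hs
  · have h1 := hmono hs
    have h3 := strictMono_changeVar.monotone (show 0 ≤ c * s by positivity)
    simp only [changeVar_zero, mul_zero, sub_zero] at h1 h3
    nlinarith
  · have h1 := hmono hs
    have h3 := strictMono_changeVar.monotone (show c * s ≤ 0 by nlinarith)
    simp only [changeVar_zero, mul_zero, sub_zero] at h1 h3
    nlinarith

theorem changeVar_mul_sq_le {c : ℝ} (hc : 0 < c) (s : ℝ) :
    changeVar (c * s) ^ 2 ≤ max 1 c ^ 2 * changeVar s ^ 2 := by
  rcases le_total 1 c with h | h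
  · rw [max_eq_right h]
    exact changeVar_mul_sq_le_of_one_le h s
  · rw [max_eq_left h]
    have := changeVar_sq_le_sq_mul ((one_le_inv₀ hc).2 h) (c * s)
    rw [inv_mul_cancel_left₀ hc.ne'] at this
    simpa using this

/-! ### Gradients of smooth functions -/

section Gradient

variable {N : ℕ}

theorem continuous_gradient {φ : EuclideanSpace ℝ (Fin N) → ℝ} (hφ : ContDiff ℝ ∞ φ) :
    Continuous (gradient φ) :=
  (LinearIsometryEquiv.continuous _).comp (hφ.continuous_fderiv (by simp))

theorem hasCompactSupport_gradient {φ : EuclideanSpace ℝ (Fin N) → ℝ}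
    (hφ : HasCompactSupport φ) : HasCompactSupport (gradient φ) :=
  (hφ.fderiv ℝ).comp_left (g := (InnerProductSpace.toDual ℝ _).symm) (map_zero _)

theorem gradient_mul_comp {h φ : EuclideanSpace ℝ (Fin N) → ℝ} {F : ℝ → ℝ}
    (hh : Differentiable ℝ h) (hφ : Differentiable ℝ φ) (hF : Differentiable ℝ F)
    (x : EuclideanSpace ℝ (Fin N)) :
    gradient (fun x => h x * F (φ x)) x
      = F (φ x) • gradient h x + (h x * deriv F (φ x)) • gradient φ x := by
  refine ext_inner_right ℝ fun e => ?_
  have h1 : HasFDerivAt (fun x => F (φ x)) (deriv F (φ x) • fderiv ℝ φ x) x :=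
    (hF (φ x)).hasDerivAt.comp_hasFDerivAt x (hφ x).hasFDerivAt
  rw [inner_gradient_left, ((hh x).hasFDerivAt.fun_mul h1).fderiv, inner_add_left,
    inner_smul_left, inner_smul_left, inner_gradient_left, inner_gradient_left]
  simp
  ring

theorem integral_smul_gradient {φ ψ : EuclideanSpace ℝ (Fin N) → ℝ} (hφ : IsTest φ)
    (hψ : IsTest ψ) : ∫ x, φ x • gradient ψ x = -∫ x, ψ x • gradient φ x := by
  have hint : ∀ {a b : EuclideanSpace ℝ (Fin N) → ℝ}, IsTest a → IsTest b →
      Integrable (fun x => a x • gradient b x) volume := fun ha hb =>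
    (ha.1.continuous.smul (continuous_gradient hb.1)).integrable_of_hasCompactSupport
      ha.2.smul_right
  refine ext_inner_right ℝ fun e => ?_
  rw [inner_neg_left, real_inner_comm, real_inner_comm e, ← integral_inner (hint hφ hψ),
    ← integral_inner (hint hψ hφ)]
  have key := integral_mul_fderiv_eq_neg_fderiv_mul_of_integrable (μ := volume) (f := φ) (g := ψ)
    (v := e) ?_ ?_ ?_ (fun x _ => (hφ.1.differentiable (by simp)) x)
    (fun x _ => (hψ.1.differentiable (by simp)) x)
  · simp only [real_inner_smul_right, inner_gradient_right, conj_trivial]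
    simpa [mul_comm] using key
  · have := (hint hψ hφ).inner_const (𝕜 := ℝ) e
    simpa only [real_inner_smul_left, inner_gradient_left, mul_comm] using this
  · have := (hint hφ hψ).inner_const (𝕜 := ℝ) e
    simpa only [real_inner_smul_left, inner_gradient_left] using this
  · exact (hφ.1.continuous.mul hψ.1.continuous).integrable_of_hasCompactSupport
      hφ.2.mul_right

end Gradient

/-! ### Passing to the limit in `L^p` -/

section Limits

variable {α F : Type*} [MeasurableSpace α] {μ : Measure α} [NormedAddCommGroup F]

theorem exists_holderTriple {p r : ℝ≥0∞} (h : r ≤ p) : ∃ q, ENNReal.HolderTriple p q r :=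
  ⟨(r⁻¹ - p⁻¹)⁻¹, ⟨by rw [inv_inv]; exact add_tsub_cancel_of_le (ENNReal.inv_le_inv.2 h)⟩⟩

theorem tendsto_integral_smul_left [NormedSpace ℝ F] {p q : ℝ≥0∞} [ENNReal.HolderConjugate p q]
    {f : ℕ → α → ℝ} {g : α → ℝ} {ψ : α → F} (hf : ∀ n, MemLp (f n) p μ) (hg : MemLp g p μ)
    (hψ : MemLp ψ q μ) (h : Tendsto (fun n => eLpNorm (fun x => f n x - g x) p μ) atTop (𝓝 0)) :
    Tendsto (fun n => ∫ x, f n x • ψ x ∂μ) atTop (𝓝 (∫ x, g x • ψ x ∂μ)) := by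
  refine tendsto_integral_of_L1' _ (hψ.smul (r := 1) hg).aestronglyMeasurable
    (Eventually.of_forall fun n => memLp_one_iff_integrable.1 (hψ.smul (r := 1) (hf n))) ?_
  have hlim := ENNReal.Tendsto.mul_const (b := eLpNorm ψ q μ) h (Or.inr hψ.2.ne)
  rw [zero_mul] at hlim
  refine tendsto_of_tendsto_of_tendsto_of_le_of_le tendsto_const_nhds hlim
    (fun _ => bot_le) fun n => ?_
  have : (fun x => f n x • ψ x) - g • ψ = (fun x => f n x - g x) • ψ := by
    ext x; simp [sub_smul]
  rw [this]
  exact eLpNorm_smul_le_mul_eLpNorm hψ.1 ((hf n).1.sub hg.1)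

theorem tendsto_integral_smul_right [NormedSpace ℝ F] {p q : ℝ≥0∞} [ENNReal.HolderConjugate p q]
    {f : ℕ → α → F} {g : α → F} {ψ : α → ℝ} (hf : ∀ n, MemLp (f n) q μ) (hg : MemLp g q μ)
    (hψ : MemLp ψ p μ) (h : Tendsto (fun n => eLpNorm (fun x => f n x - g x) q μ) atTop (𝓝 0)) :
    Tendsto (fun n => ∫ x, ψ x • f n x ∂μ) atTop (𝓝 (∫ x, ψ x • g x ∂μ)) := by
  refine tendsto_integral_of_L1' _ (hg.smul (r := 1) hψ).aestronglyMeasurable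
    (Eventually.of_forall fun n => memLp_one_iff_integrable.1 ((hf n).smul (r := 1) hψ)) ?_
  have hlim := ENNReal.Tendsto.const_mul (a := eLpNorm ψ p μ) h (Or.inr hψ.2.ne)
  rw [mul_zero] at hlim
  refine tendsto_of_tendsto_of_tendsto_of_le_of_le tendsto_const_nhds hlim
    (fun _ => bot_le) fun n => ?_
  have : (fun x => ψ x • f n x) - ψ • g = ψ • (fun x => f n x - g x) := by
    ext x; simp [smul_sub]
  rw [this]
  exact eLpNorm_smul_le_mul_eLpNorm ((hf n).1.sub hg.1) hψ.1

theorem memLp_of_tendsto_eLpNorm {p : ℝ≥0∞} {f : ℕ → α → F} {g : α → F}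
    (hf : ∀ n, MemLp (f n) p μ) (hg : AEStronglyMeasurable g μ)
    (h : Tendsto (fun n => eLpNorm (fun x => f n x - g x) p μ) atTop (𝓝 0)) : MemLp g p μ := by
  obtain ⟨n, hn⟩ := (h.eventually_lt_const (show (0 : ℝ≥0∞) < ⊤ by simp)).exists
  have : MemLp (fun x => f n x - g x) p μ := ⟨(hf n).1.sub hg, hn⟩
  have := (hf n).sub this
  refine this.ae_eq (Eventually.of_forall fun x => ?_)
  simp

/-- Dominated convergence with majorant `‖C • g‖²`. It serves coefficients `F'(φ n) - F'(u)`, which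
converge only almost everywhere. -/
theorem tendsto_eLpNorm_two_smul {f : ℕ → α → ℝ} {C : ℝ} {g : α → F} [NormedSpace ℝ F]
    (hg : MemLp g 2 μ) (hf : ∀ n, AEStronglyMeasurable (f n) μ) (hC : ∀ n x, |f n x| ≤ C)
    (h : ∀ᵐ x ∂μ, Tendsto (fun n => f n x) atTop (𝓝 0)) :
    Tendsto (fun n => eLpNorm (fun x => f n x • g x) 2 μ) atTop (𝓝 0) := by
  simp only [eLpNorm_eq_lintegral_rpow_enorm_toReal two_ne_zero ENNReal.ofNat_ne_top]
  have hint : ∫⁻ x, ‖C • g x‖ₑ ^ (2 : ℝ≥0∞).toReal ∂μ ≠ ⊤ :=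
    (lintegral_rpow_enorm_lt_top_of_eLpNorm_lt_top two_ne_zero ENNReal.ofNat_ne_top
      (hg.const_smul C).2).ne
  have key : Tendsto (fun n => ∫⁻ x, ‖f n x • g x‖ₑ ^ (2 : ℝ≥0∞).toReal ∂μ) atTop
      (𝓝 (∫⁻ _, 0 ∂μ)) := by
    refine tendsto_lintegral_of_dominated_convergence' _
      (fun n => ((hf n).smul hg.1).enorm.pow_const _)
      (fun n => Eventually.of_forall fun x => ?_) hint ?_
    · refine ENNReal.rpow_le_rpow ?_ (by simp)
      rw [enorm_le_iff_norm_le, norm_smul, norm_smul]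
      exact mul_le_mul_of_nonneg_right ((hC n x).trans (le_abs_self C)) (norm_nonneg _)
    · filter_upwards [h] with x hx
      have h1 : Tendsto (fun n => ‖f n x • g x‖ₑ) atTop (𝓝 0) := by
        simpa using (hx.smul_const (g x)).enorm
      simpa using h1.ennrpow_const (2 : ℝ≥0∞).toReal
  rw [lintegral_zero] at key
  simpa using key.ennrpow_const (1 / (2 : ℝ≥0∞).toReal)

theorem exists_subseq_tendsto_ae {p : ℝ≥0∞} (hp : p ≠ 0) {f : ℕ → α → F} {g : α → F}
    (hf : ∀ n, AEStronglyMeasurable (f n) μ) (hg : AEStronglyMeasurable g μ)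
    (h : Tendsto (fun n => eLpNorm (fun x => f n x - g x) p μ) atTop (𝓝 0)) :
    ∃ ns : ℕ → ℕ, StrictMono ns ∧ ∀ᵐ x ∂μ, Tendsto (fun i => f (ns i) x) atTop (𝓝 (g x)) :=
  (tendstoInMeasure_of_tendsto_eLpNorm hp hf hg h).exists_seq_tendsto_ae

end Limits

/-! ### Weak gradients -/

section WeakGradient

variable {N : ℕ}

/-- The fundamental lemma of the calculus of variations, applied to the difference. It ties the
chosen `weakGradient` to any explicitly computed gradient. -/
theorem IsWeakGradient.ae_eq {u : EuclideanSpace ℝ (Fin N) → ℝ}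
    {G H : EuclideanSpace ℝ (Fin N) → EuclideanSpace ℝ (Fin N)}
    (hG : IsWeakGradient u G) (hH : IsWeakGradient u H) : G =ᵐ[volume] H := by
  have key := ae_eq_zero_of_integral_contDiff_smul_eq_zero (hG.2.1.sub hH.2.1) fun ψ hψ hψc => by
    have hi : ∀ {K : EuclideanSpace ℝ (Fin N) → EuclideanSpace ℝ (Fin N)},
        LocallyIntegrable K volume → Integrable (fun x => ψ x • K x) volume := fun hK =>
      hK.integrable_smul_left_of_hasCompactSupport hψ.continuous hψc
    have h1 := hG.2.2 ψ ⟨hψ, hψc⟩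
    have h2 := hH.2.2 ψ ⟨hψ, hψc⟩
    simp only [Pi.sub_apply, smul_sub]
    rw [integral_sub (hi hG.2.1) (hi hH.2.1), sub_eq_zero]
    exact neg_injective (h1.symm.trans h2)
  filter_upwards [key] with x hx
  simpa [sub_eq_zero] using hx

theorem IsWeakGradient.weakGradient_ae_eq {u : EuclideanSpace ℝ (Fin N) → ℝ}
    {G : EuclideanSpace ℝ (Fin N) → EuclideanSpace ℝ (Fin N)}
    (hG : IsWeakGradient u G) : weakGradient u =ᵐ[volume] G := by
  have h : ∃ G, IsWeakGradient u G := ⟨G, hG⟩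
  rw [weakGradient, dif_pos h]
  exact (Classical.choose_spec h).ae_eq hG

theorem IsWeakGradient.add_const_mul {u v : EuclideanSpace ℝ (Fin N) → ℝ}
    {G H : EuclideanSpace ℝ (Fin N) → EuclideanSpace ℝ (Fin N)}
    (hG : IsWeakGradient u G) (hH : IsWeakGradient v H) (t : ℝ) :
    IsWeakGradient (fun x => u x + t * v x) (fun x => G x + t • H x) := by
  refine ⟨hG.1.add (hH.1.smul t), hG.2.1.add (hH.2.1.smul t), fun ψ hψ => ?_⟩
  have hi : ∀ {K : EuclideanSpace ℝ (Fin N) → EuclideanSpace ℝ (Fin N)},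
      LocallyIntegrable K volume → Integrable (fun x => ψ x • K x) volume := fun hK =>
    hK.integrable_smul_left_of_hasCompactSupport hψ.1.continuous hψ.2
  have hi' : ∀ {k : EuclideanSpace ℝ (Fin N) → ℝ},
      LocallyIntegrable k volume → Integrable (fun x => k x • gradient ψ x) volume := fun hK =>
    hK.integrable_smul_right_of_hasCompactSupport (continuous_gradient hψ.1)
      (hasCompactSupport_gradient hψ.2)
  have e1 : ∀ x, (u x + t * v x) • gradient ψ x = u x • gradient ψ x + t • v x • gradient ψ x :=
    fun x => by rw [add_smul, mul_smul]
  have e2 : ∀ x, ψ x • (G x + t • H x) = ψ x • G x + t • ψ x • H x :=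
    fun x => by rw [smul_add, smul_comm]
  simp only [e1, e2]
  have s1 := integral_add (hi' hG.1) ((hi' hH.1).smul t)
  have s2 := integral_add (hi hG.2.1) ((hi hH.2.1).smul t)
  simp only [Pi.smul_apply] at s1 s2
  rw [s1, s2, integral_smul, integral_smul, hG.2.2 ψ hψ, hH.2.2 ψ hψ, smul_neg, neg_add]

end WeakGradient

/-! ### The space `D_r^{1,2}` -/

section RadialSpace

variable {N : ℕ}

theorem two_le_sobolevExp (hN : 3 ≤ N) : 2 ≤ sobolevExp N := by
  have h : (3 : ℝ) ≤ N := by exact_mod_cast hN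
  rw [sobolevExp, ← ENNReal.ofReal_ofNat 2]
  refine ENNReal.ofReal_le_ofReal ?_
  rw [le_div_iff₀ (by linarith)]
  linarith

/-- `u` belongs to `D_r^{1,2}` and has the weak gradient `G`. -/
def HasRadialGradient (u : EuclideanSpace ℝ (Fin N) → ℝ)
    (G : EuclideanSpace ℝ (Fin N) → EuclideanSpace ℝ (Fin N)) : Prop :=
  MemLp u (sobolevExp N) volume ∧ IsWeakGradient u G ∧ MemLp G 2 volume ∧
    ∃ φ : ℕ → EuclideanSpace ℝ (Fin N) → ℝ, (∀ n, IsRadialTest (φ n)) ∧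
      Tendsto (fun n => eLpNorm (fun x => φ n x - u x) (sobolevExp N) volume) atTop (𝓝 0) ∧
      Tendsto (fun n => eLpNorm (fun x => gradient (φ n) x - G x) 2 volume) atTop (𝓝 0)

theorem memD_iff {u : EuclideanSpace ℝ (Fin N) → ℝ} : MemD u ↔ ∃ G, HasRadialGradient u G :=
  ⟨fun ⟨h, G, h'⟩ => ⟨G, h, h'⟩, fun ⟨G, h, h'⟩ => ⟨h, G, h'⟩⟩

theorem IsTest.memLp {φ : EuclideanSpace ℝ (Fin N) → ℝ} (hφ : IsTest φ) (p : ℝ≥0∞) :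
    MemLp φ p volume :=
  hφ.1.continuous.memLp_of_hasCompactSupport hφ.2

theorem IsTest.memLp_gradient {φ : EuclideanSpace ℝ (Fin N) → ℝ} (hφ : IsTest φ) (p : ℝ≥0∞) :
    MemLp (gradient φ) p volume :=
  (continuous_gradient hφ.1).memLp_of_hasCompactSupport (hasCompactSupport_gradient hφ.2)

/-- Integration by parts for the test functions `φ n` passes to the limit by Hölder's inequality, so
an approximating sequence alone certifies both the integrability and the weak gradient. -/
theorem HasRadialGradient.of_tendsto (hN : 3 ≤ N) {u : EuclideanSpace ℝ (Fin N) → ℝ}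
    {G : EuclideanSpace ℝ (Fin N) → EuclideanSpace ℝ (Fin N)}
    {φ : ℕ → EuclideanSpace ℝ (Fin N) → ℝ} (hφ : ∀ n, IsRadialTest (φ n))
    (hum : AEStronglyMeasurable u volume) (hGm : AEStronglyMeasurable G volume)
    (hu : Tendsto (fun n => eLpNorm (fun x => φ n x - u x) (sobolevExp N) volume) atTop (𝓝 0))
    (hG : Tendsto (fun n => eLpNorm (fun x => gradient (φ n) x - G x) 2 volume) atTop (𝓝 0)) :
    HasRadialGradient u G := by
  have hp := two_le_sobolevExp hN
  have hp1 : 1 ≤ sobolevExp N := one_le_two.trans hp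
  have hul : MemLp u (sobolevExp N) volume :=
    memLp_of_tendsto_eLpNorm (fun n => (hφ n).1.memLp _) hum hu
  have hGl : MemLp G 2 volume :=
    memLp_of_tendsto_eLpNorm (fun n => (hφ n).1.memLp_gradient _) hGm hG
  refine ⟨hul, ⟨hul.locallyIntegrable hp1, hGl.locallyIntegrable one_le_two, fun ψ hψ => ?_⟩,
    hGl, φ, hφ, hu, hG⟩
  obtain ⟨q, hq⟩ := exists_holderTriple hp1
  obtain ⟨q', hq'⟩ := exists_holderTriple (one_le_two (α := ℝ≥0∞))
  have l1 := tendsto_integral_smul_left (fun n => (hφ n).1.memLp _) hul (hψ.memLp_gradient q) hu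
  have : ENNReal.HolderConjugate q' 2 := hq'.symm
  have l2 := tendsto_integral_smul_right (p := q') (fun n => (hφ n).1.memLp_gradient 2) hGl
    (hψ.memLp q') hG
  simp only [fun n => integral_smul_gradient (hφ n).1 hψ] at l1
  exact tendsto_nhds_unique l1 l2.neg

theorem HasRadialGradient.exists_seq (hN : 3 ≤ N) {u : EuclideanSpace ℝ (Fin N) → ℝ}
    {G : EuclideanSpace ℝ (Fin N) → EuclideanSpace ℝ (Fin N)} (h : HasRadialGradient u G) :
    ∃ φ : ℕ → EuclideanSpace ℝ (Fin N) → ℝ, (∀ n, IsRadialTest (φ n)) ∧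
      Tendsto (fun n => eLpNorm (fun x => φ n x - u x) (sobolevExp N) volume) atTop (𝓝 0) ∧
      Tendsto (fun n => eLpNorm (fun x => gradient (φ n) x - G x) 2 volume) atTop (𝓝 0) ∧
      ∀ᵐ x, Tendsto (fun n => φ n x) atTop (𝓝 (u x)) := by
  obtain ⟨hu, -, hG, φ, hφ, h1, h2⟩ := h
  have hp : sobolevExp N ≠ 0 := fun h0 => by simpa [h0] using two_le_sobolevExp hN
  obtain ⟨ns, hns, hae⟩ := exists_subseq_tendsto_ae hp (fun n => ((hφ n).1.memLp 1).1) hu.1 h1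
  exact ⟨fun n => φ (ns n), fun n => hφ _, h1.comp hns.tendsto_atTop, h2.comp hns.tendsto_atTop,
    hae⟩

/-- Products of a radial smooth function with a function of an element of `D_r^{1,2}`. -/
theorem HasRadialGradient.mul_comp (hN : 3 ≤ N) {u : EuclideanSpace ℝ (Fin N) → ℝ}
    {G : EuclideanSpace ℝ (Fin N) → EuclideanSpace ℝ (Fin N)} (hu : HasRadialGradient u G)
    {h : EuclideanSpace ℝ (Fin N) → ℝ} {F : ℝ → ℝ} {A C : ℝ} (hh : ContDiff ℝ ∞ h)
    (hhr : ∀ x y, ‖x‖ = ‖y‖ → h x = h y) (hA : ∀ x, |h x| ≤ A)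
    (hgrad : HasCompactSupport (gradient h)) (hF : ContDiff ℝ ∞ F) (hC : ∀ s, |deriv F s| ≤ C)
    (hsupp : HasCompactSupport h ∨ F 0 = 0) :
    HasRadialGradient (fun x => h x * F (u x))
      (fun x => F (u x) • gradient h x + (h x * deriv F (u x)) • G x) := by
  obtain ⟨φ, hφ, hφu, hφG, hae⟩ := hu.exists_seq hN
  have hFd : Differentiable ℝ F := hF.differentiable (by simp)
  have hF'c : Continuous (deriv F) := hF.continuous_deriv (by simp)
  have hum := hu.1.1
  have hGm := hu.2.2.1.1
  have hC0 : 0 ≤ C := (abs_nonneg _).trans (hC 0)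
  have hA0 : 0 ≤ A := (abs_nonneg _).trans (hA 0)
  have hLip := abs_sub_le_of_abs_deriv_le hFd hC
  have hFum : AEStronglyMeasurable (fun x => F (u x)) volume :=
    hF.continuous.comp_aestronglyMeasurable hum
  have hF'um : AEStronglyMeasurable (fun x => deriv F (u x)) volume :=
    hF'c.comp_aestronglyMeasurable hum
  have hhm : AEStronglyMeasurable h volume := hh.continuous.aestronglyMeasurable
  have hgc : Continuous (gradient h) := continuous_gradient hh
  refine HasRadialGradient.of_tendsto hN (φ := fun n x => h x * F (φ n x)) (fun n => ⟨⟨?_, ?_⟩, ?_⟩)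
    (hhm.mul hFum) ((hFum.smul hgc.aestronglyMeasurable).add ((hhm.mul hF'um).smul hGm)) ?_ ?_
  · exact hh.mul (hF.comp (hφ n).1.1)
  · rcases hsupp with hs | hs
    · exact hs.mul_right
    · exact ((hφ n).1.2.comp_left hs).mul_left
  · intro x y hxy
    simp only [hhr x y hxy, (hφ n).2 x y hxy]
  · have hlim := ENNReal.Tendsto.const_mul (a := ENNReal.ofReal (A * C)) hφu
      (Or.inr ENNReal.ofReal_ne_top)
    rw [mul_zero] at hlim
    refine tendsto_of_tendsto_of_tendsto_of_le_of_le tendsto_const_nhds hlim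
      (fun _ => bot_le) fun n => ?_
    refine eLpNorm_le_mul_eLpNorm_of_ae_le_mul (Eventually.of_forall fun x => ?_) _
    rw [← mul_sub, norm_mul, mul_assoc]
    exact mul_le_mul (hA x) (hLip _ _) (abs_nonneg _) hA0
  -- The exponent `q` satisfies `1/2* + 1/q = 1/2`, so the `L^{2*}` convergence of `F(φ n)` times
  -- `∇h ∈ L^q` converges in `L²`. The error in the gradient splits into this term, one carrying
  -- `∇(φ n) - G`, and one carrying `F'(φ n) - F'(u)`.
  · obtain ⟨q, hq⟩ := exists_holderTriple (two_le_sobolevExp hN)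
    have hgq : MemLp (gradient h) q volume := hgc.memLp_of_hasCompactSupport hgrad
    have l1 : Tendsto (fun n => eLpNorm ((fun x => F (φ n x) - F (u x)) • gradient h) 2 volume)
        atTop (𝓝 0) := by
      have hlim := ENNReal.Tendsto.mul_const (b := eLpNorm (gradient h) q volume)
        (ENNReal.Tendsto.const_mul (a := ENNReal.ofReal C) hφu (Or.inr ENNReal.ofReal_ne_top))
        (Or.inr hgq.2.ne)
      rw [mul_zero, zero_mul] at hlim
      refine tendsto_of_tendsto_of_tendsto_of_le_of_le tendsto_const_nhds hlim
        (fun _ => bot_le) fun n => ?_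
      refine (eLpNorm_smul_le_mul_eLpNorm (p := sobolevExp N) (q := q) hgq.1
        ((hF.continuous.comp_aestronglyMeasurable ((hφ n).1.memLp 1).1).sub hFum)).trans ?_
      gcongr
      exact eLpNorm_le_mul_eLpNorm_of_ae_le_mul (Eventually.of_forall fun x => hLip _ _) _
    have l2 : Tendsto (fun n => eLpNorm (fun x => (h x * deriv F (φ n x)) •
        (gradient (φ n) x - G x)) 2 volume) atTop (𝓝 0) := by
      have hlim := ENNReal.Tendsto.const_mul (a := ENNReal.ofReal (A * C)) hφG
        (Or.inr ENNReal.ofReal_ne_top)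
      rw [mul_zero] at hlim
      refine tendsto_of_tendsto_of_tendsto_of_le_of_le tendsto_const_nhds hlim
        (fun _ => bot_le) fun n => ?_
      refine eLpNorm_le_mul_eLpNorm_of_ae_le_mul (Eventually.of_forall fun x => ?_) _
      rw [norm_smul, norm_mul]
      exact mul_le_mul_of_nonneg_right (mul_le_mul (hA x) (hC _) (abs_nonneg _) hA0)
        (norm_nonneg _)
    have hm3 : ∀ n, AEStronglyMeasurable
        (fun x => h x * (deriv F (φ n x) - deriv F (u x))) volume := fun n =>
      hhm.mul ((hF'c.comp_aestronglyMeasurable ((hφ n).1.memLp 1).1).sub hF'um)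
    have l3 : Tendsto (fun n => eLpNorm (fun x => (h x * (deriv F (φ n x) - deriv F (u x))) • G x)
        2 volume) atTop (𝓝 0) := by
      refine tendsto_eLpNorm_two_smul (C := A * (C + C)) hu.2.2.1 hm3 (fun n x => ?_) ?_
      · rw [abs_mul]
        exact mul_le_mul (hA x) ((abs_sub _ _).trans (add_le_add (hC _) (hC _))) (abs_nonneg _) hA0
      · filter_upwards [hae] with x hx
        have := ((hF'c.tendsto (u x)).comp hx).sub_const (deriv F (u x))
        simpa using this.const_mul (h x)
    have hlim := (l1.add l2).add l3
    rw [add_zero, add_zero] at hlim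
    refine tendsto_of_tendsto_of_tendsto_of_le_of_le tendsto_const_nhds hlim
      (fun _ => bot_le) fun n => ?_
    have hm1 : AEStronglyMeasurable ((fun x => F (φ n x) - F (u x)) • gradient h) volume :=
      ((hF.continuous.comp_aestronglyMeasurable ((hφ n).1.memLp 1).1).sub hFum).smul
        hgc.aestronglyMeasurable
    have hm2 : AEStronglyMeasurable (fun x => (h x * deriv F (φ n x)) •
        (gradient (φ n) x - G x)) volume :=
      (hhm.mul (hF'c.comp_aestronglyMeasurable ((hφ n).1.memLp 1).1)).smul
        (((hφ n).1.memLp_gradient 1).1.sub hGm)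
    refine le_trans (le_of_eq ?_) ((eLpNorm_add_le (hm1.add hm2) ((hm3 n).smul hGm)
      one_le_two).trans (add_le_add (eLpNorm_add_le hm1 hm2 one_le_two) le_rfl))
    congr 1
    funext x
    rw [gradient_mul_comp (hh.differentiable (by simp)) ((hφ n).1.1.differentiable (by simp)) hFd]
    simp only [Pi.add_apply, Pi.smul_apply', smul_sub, sub_smul, mul_sub]
    module

theorem HasRadialGradient.const_mul (hN : 3 ≤ N) {u : EuclideanSpace ℝ (Fin N) → ℝ}
    {G : EuclideanSpace ℝ (Fin N) → EuclideanSpace ℝ (Fin N)} (hu : HasRadialGradient u G)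
    (c : ℝ) : HasRadialGradient (fun x => c * u x) (fun x => c • G x) := by
  have hg : gradient (fun _ : EuclideanSpace ℝ (Fin N) => c) = fun _ => 0 :=
    funext fun x => gradient_fun_const x c
  -- A constant multiplier is allowed because only its gradient, here zero, must have compact
  -- support; the approximants stay compactly supported since `id 0 = 0`.
  have := hu.mul_comp hN (h := fun _ => c) (F := id) (A := |c|) (C := 1) contDiff_const
    (fun _ _ _ => rfl) (fun _ => le_rfl) (by rw [hg]; exact HasCompactSupport.zero) contDiff_id
    (by simp) (Or.inr rfl)
  simpa [hg] using this

/-- The change of variable maps `D_r^{1,2}` into itself. -/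
theorem HasRadialGradient.changeVar_comp (hN : 3 ≤ N) {u : EuclideanSpace ℝ (Fin N) → ℝ}
    {G : EuclideanSpace ℝ (Fin N) → EuclideanSpace ℝ (Fin N)} (hu : HasRadialGradient u G) :
    HasRadialGradient (fun x => changeVar (u x)) (fun x => (1 / invDeriv (u x)) • G x) := by
  have hg : gradient (fun _ : EuclideanSpace ℝ (Fin N) => (1 : ℝ)) = fun _ => 0 :=
    funext fun x => gradient_fun_const x 1
  have := hu.mul_comp hN (h := fun _ => 1) (A := 1) contDiff_const
    (fun _ _ _ => rfl) (by simp) (by rw [hg]; exact HasCompactSupport.zero) contDiff_changeVar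
    abs_deriv_changeVar_le (Or.inr changeVar_zero)
  simpa [hg, deriv_changeVar] using this

/-- The test direction `h / f'(u)` belongs to `D_r^{1,2}`. -/
theorem HasRadialGradient.mul_invDeriv (hN : 3 ≤ N) {u : EuclideanSpace ℝ (Fin N) → ℝ}
    {G : EuclideanSpace ℝ (Fin N) → EuclideanSpace ℝ (Fin N)} (hu : HasRadialGradient u G)
    {h : EuclideanSpace ℝ (Fin N) → ℝ} (hh : IsRadialTest h) :
    HasRadialGradient (fun x => h x * invDeriv (u x)) (fun x => invDeriv (u x) • gradient h x
      + (h x * (2 * changeVar (u x) / invDeriv (u x) ^ 2)) • G x) := by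
  obtain ⟨A, hA⟩ := hh.1.1.continuous.bounded_above_of_compact_support hh.1.2
  have := hu.mul_comp hN (A := A) hh.1.1 hh.2 hA (hasCompactSupport_gradient hh.1.2)
    contDiff_invDeriv abs_deriv_invDeriv_le (Or.inl hh.1.2)
  simpa [(hasDerivAt_invDeriv _).deriv] using this

theorem HasRadialGradient.normD_eq {u : EuclideanSpace ℝ (Fin N) → ℝ}
    {G : EuclideanSpace ℝ (Fin N) → EuclideanSpace ℝ (Fin N)} (hu : HasRadialGradient u G) :
    normD u = √(∫ x, ‖G x‖ ^ 2) := by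
  rw [normD]
  congr 1
  refine integral_congr_ae ?_
  filter_upwards [hu.2.1.weakGradient_ae_eq] with x hx
  rw [hx]

end RadialSpace

/-! ### Pointwise decay of radial functions -/

section RadialBound

variable {N : ℕ}

theorem sq_le_four_mul_of_forall_le {a A B : ℝ} (hA : 0 < A) (hB : 0 ≤ B) (ha : 0 ≤ a)
    (h : ∀ t, 0 < t → a ≤ t * A + B / t) : a ^ 2 ≤ 4 * (A * B) := by
  rcases ha.eq_or_lt with rfl | ha
  · nlinarith [mul_nonneg hA.le hB]
  -- This `t` makes `t * A` equal to `a / 2`, which is then absorbed on the left.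
  · have h1 := h (a / (2 * A)) (by positivity)
    have e : a / (2 * A) * A + B / (a / (2 * A)) = a / 2 + 2 * (A * B) / a := by
      field_simp
    rw [e] at h1
    have h2 : a / 2 ≤ 2 * (A * B) / a := by linarith
    rw [le_div_iff₀ ha] at h2
    nlinarith

/-- Young's inequality with weight `a`, obtained by completing the square. -/
theorem abs_le_mul_inv_add {a t : ℝ} (ha : 0 < a) (ht : 0 < t) (y : ℝ) :
    |y| ≤ t * a⁻¹ + a * y ^ 2 / t := by
  have e : t * a⁻¹ + a * y ^ 2 / t - |y|
      = ((t - a * |y|) ^ 2 + t * (a * |y|)) / (a * t) := by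
    rw [← sq_abs y]
    field_simp
    ring
  have : 0 ≤ t * a⁻¹ + a * y ^ 2 / t - |y| := by
    rw [e]; positivity
  linarith

/-- Write `p r` as minus the integral of `p'` over `(r, ∞)` and split `|p'|` by Young's inequality
with weight `s ^ m`; `m ≥ 2` makes `s ^ (-m)` integrable at infinity. Keeping `t` free replaces the
Cauchy–Schwarz inequality: optimising in `t` recovers it up to a constant. -/
theorem abs_profile_le {p : ℝ → ℝ} (hp : ContDiff ℝ ∞ p) (hpc : HasCompactSupport p)
    {m : ℕ} (hm : 2 ≤ m) {R r : ℝ} (hR : 0 < R) (hr : R ≤ r) {t : ℝ} (ht : 0 < t) :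
    |p r| ≤ t * (∫ s in Set.Ioi R, s ^ (-(m : ℝ)))
      + (∫ s in Set.Ioi (0 : ℝ), s ^ m * deriv p s ^ 2) / t := by
  have hm1 : -(m : ℝ) < -1 := by
    have : (2 : ℝ) ≤ m := by exact_mod_cast hm
    linarith
  have hp' : Continuous (deriv p) := hp.continuous_deriv (by simp)
  have hp'c : HasCompactSupport (deriv p) := hpc.deriv
  have hr0 : 0 < r := hR.trans_le hr
  have hint' : Integrable (deriv p) := hp'.integrable_of_hasCompactSupport hp'c
  have hlim : Tendsto p atTop (𝓝 0) :=
    (hpc.is_zero_at_infty).mono_left atTop_le_cocompact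
  have hFTC : ∫ s in Set.Ioi r, deriv p s = 0 - p r :=
    integral_Ioi_of_hasDerivAt_of_tendsto hp.continuous.continuousWithinAt
      (fun x _ => (hp.differentiable (by simp) x).hasDerivAt) hint'.integrableOn hlim
  have hw : Integrable (fun s => s ^ m * deriv p s ^ 2) := by
    have h2 : HasCompactSupport fun s => deriv p s ^ 2 :=
      hp'c.comp_left (g := fun y => y ^ 2) (by simp)
    have hc : Continuous fun s => s ^ m * deriv p s ^ 2 := by fun_prop
    exact hc.integrable_of_hasCompactSupport h2.mul_left
  have hpow : IntegrableOn (fun s : ℝ => s ^ (-(m : ℝ))) (Set.Ioi R) :=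
    integrableOn_Ioi_rpow_of_lt hm1 hR
  have hsub : Set.Ioi r ⊆ Set.Ioi R := Set.Ioi_subset_Ioi hr
  calc |p r| = |∫ s in Set.Ioi r, deriv p s| := by rw [hFTC]; simp
    _ ≤ ∫ s in Set.Ioi r, |deriv p s| := abs_integral_le_integral_abs
    _ ≤ ∫ s in Set.Ioi r, (t * s ^ (-(m : ℝ)) + (s ^ m * deriv p s ^ 2) / t) := by
        refine setIntegral_mono_on hint'.abs.integrableOn
          (((hpow.mono_set hsub).const_mul t).add (hw.integrableOn.div_const t))
          measurableSet_Ioi fun s hs => ?_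
        have hs0 : 0 < s := hr0.trans hs
        rw [Real.rpow_neg hs0.le, Real.rpow_natCast]
        have hsm : 0 < s ^ m := pow_pos hs0 m
        exact abs_le_mul_inv_add hsm ht _
    _ = t * (∫ s in Set.Ioi r, s ^ (-(m : ℝ)))
          + (∫ s in Set.Ioi r, s ^ m * deriv p s ^ 2) / t := by
        rw [integral_add ((hpow.mono_set hsub).const_mul t) (hw.integrableOn.div_const t),
          integral_const_mul, integral_div]
    _ ≤ _ := by
        have i1 : ∫ s in Set.Ioi r, s ^ (-(m : ℝ)) ≤ ∫ s in Set.Ioi R, s ^ (-(m : ℝ)) :=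
          setIntegral_mono_set hpow ((ae_restrict_iff' measurableSet_Ioi).2 <|
            Eventually.of_forall fun s hs => Real.rpow_nonneg (hR.trans hs).le _)
            hsub.eventuallyLE
        have i2 : ∫ s in Set.Ioi r, s ^ m * deriv p s ^ 2
            ≤ ∫ s in Set.Ioi (0 : ℝ), s ^ m * deriv p s ^ 2 :=
          setIntegral_mono_set hw.integrableOn ((ae_restrict_iff' measurableSet_Ioi).2 <|
            Eventually.of_forall fun s hs => mul_nonneg (pow_nonneg (le_of_lt hs) _) (sq_nonneg _))
            (Set.Ioi_subset_Ioi hr0.le).eventuallyLE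
        gcongr

/-- A Strauss-type estimate: the profile bound with weight `s ^ (N - 1)`, whose energy is at most
the Dirichlet integral in polar coordinates because the radial derivative is bounded by the
gradient. -/
theorem IsRadialTest.abs_le (hN : 3 ≤ N) {R : ℝ} (hR : 0 < R) :
    ∃ C, 0 < C ∧ ∀ φ : EuclideanSpace ℝ (Fin N) → ℝ, IsRadialTest φ → ∀ x, R ≤ ‖x‖ →
      φ x ^ 2 ≤ C * ∫ y, ‖gradient φ y‖ ^ 2 := by
  have hm : 2 ≤ N - 1 := by omega
  have hN0 : 0 < N := by omega
  have : Nonempty (Fin N) := ⟨⟨0, hN0⟩⟩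
  have : Nontrivial (EuclideanSpace ℝ (Fin N)) := inferInstance
  obtain ⟨e, he⟩ := exists_norm_eq (EuclideanSpace ℝ (Fin N)) (zero_le_one (α := ℝ))
  set A : ℝ := ∫ s in Set.Ioi R, s ^ (-((N - 1 : ℕ) : ℝ)) with hAdef
  -- The area of the unit sphere, as it appears in the polar coordinate formula.
  set b : ℝ := N * (volume : Measure (EuclideanSpace ℝ (Fin N))).real (Metric.ball 0 1) with hb
  have hb0 : 0 < b := by
    have h1 : 0 < (volume : Measure (EuclideanSpace ℝ (Fin N))).real (Metric.ball 0 1) :=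
      ENNReal.toReal_pos (Metric.measure_ball_pos _ _ one_pos).ne' measure_ball_lt_top.ne
    positivity
  have hm1 : -((N - 1 : ℕ) : ℝ) < -1 := by
    have : (2 : ℝ) ≤ (N - 1 : ℕ) := by exact_mod_cast hm
    linarith
  have hA : 0 < A := by
    rw [hAdef, integral_Ioi_rpow_of_lt hm1 hR]
    have := Real.rpow_pos_of_pos hR (-((N - 1 : ℕ) : ℝ) + 1)
    rw [neg_div, ← div_neg]
    exact div_pos this (by linarith)
  refine ⟨4 * A / b, by positivity, fun φ hφ x hx => ?_⟩
  have hφd : Differentiable ℝ φ := hφ.1.1.differentiable (by simp)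
  set p : ℝ → ℝ := fun s => φ (s • e) with hpdef
  have hp : ContDiff ℝ ∞ p := hφ.1.1.comp (contDiff_id.smul contDiff_const)
  have hpc : HasCompactSupport p := by
    refine hφ.1.2.comp_isClosedEmbedding (g := fun s : ℝ => s • e) ?_
    exact (LinearMap.toSpanSingleton ℝ _ e).isClosedEmbedding_of_injective
      (LinearMap.ker_eq_bot.2 (smul_left_injective ℝ (fun h0 => by simp [h0] at he)))
  have hφp : ∀ y, φ y = p ‖y‖ := fun y => hφ.2 _ _ (by simp [norm_smul, he])
  have hp' : Continuous (deriv p) := hp.continuous_deriv (by simp)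
  -- By radial symmetry the profile can be read along the ray through `y`, where its derivative is a
  -- directional derivative of `φ`.
  have hgrad : ∀ y, y ≠ 0 → |deriv p ‖y‖| ≤ ‖gradient φ y‖ := by
    intro y hy
    have hy' : ‖y‖ ≠ 0 := norm_ne_zero_iff.2 hy
    set n := ‖y‖⁻¹ • y with hn
    have hn1 : ‖n‖ = 1 := by rw [hn, norm_smul, norm_inv, norm_norm, inv_mul_cancel₀ hy']
    have hpn : p = fun s => φ (s • n) := funext fun s =>
      hφ.2 _ _ (by simp [norm_smul, he, hn1])
    have hyn : ‖y‖ • n = y := by rw [hn, smul_smul, mul_inv_cancel₀ hy', one_smul]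
    have hd : HasDerivAt p (inner ℝ (gradient φ y) n) ‖y‖ := by
      rw [hpn, inner_gradient_left]
      have h1 : HasDerivAt (fun s : ℝ => s • n) n ‖y‖ := by
        simpa using (hasDerivAt_id ‖y‖).smul_const n
      have h2 : HasFDerivAt φ (fderiv ℝ φ y) (‖y‖ • n) := by
        rw [hyn]; exact (hφd y).hasFDerivAt
      exact h2.comp_hasDerivAt ‖y‖ h1
    rw [hd.deriv]
    simpa [hn1] using abs_real_inner_le_norm (gradient φ y) n
  have hgint : Integrable (fun y => ‖gradient φ y‖ ^ 2) :=
    (hφ.1.memLp_gradient 2).integrable_norm_pow two_ne_zero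
  have hpol := integral_fun_norm_addHaar (volume : Measure (EuclideanSpace ℝ (Fin N)))
    (fun s => deriv p s ^ 2)
  rw [finrank_euclideanSpace_fin] at hpol
  simp only [smul_eq_mul, nsmul_eq_mul] at hpol
  set B : ℝ := ∫ s in Set.Ioi (0 : ℝ), s ^ (N - 1) * deriv p s ^ 2 with hBdef
  have hBle : B ≤ (∫ y, ‖gradient φ y‖ ^ 2) / b := by
    rw [le_div_iff₀ hb0, mul_comm, hb, mul_assoc, ← hpol]
    refine integral_mono_of_nonneg (Eventually.of_forall fun y => sq_nonneg _) hgint ?_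
    filter_upwards [measure_eq_zero_iff_ae_notMem.1
      (measure_singleton (μ := volume) (0 : EuclideanSpace ℝ (Fin N)))] with y hy
    rw [← sq_abs (deriv p ‖y‖)]
    exact pow_le_pow_left₀ (abs_nonneg _) (hgrad y hy) 2
  have hB0 : 0 ≤ B := setIntegral_nonneg measurableSet_Ioi fun s hs =>
    mul_nonneg (pow_nonneg (le_of_lt hs) _) (sq_nonneg _)
  have key := sq_le_four_mul_of_forall_le hA hB0 (abs_nonneg (p ‖x‖))
    fun t ht => abs_profile_le hp hpc hm hR hx ht
  rw [hφp x, ← sq_abs]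
  calc _ ≤ 4 * (A * B) := key
    _ ≤ 4 * (A * ((∫ y, ‖gradient φ y‖ ^ 2) / b)) := by gcongr
    _ = _ := by ring

/-- The constant for test functions depends only on `N` and `R`, so the bound survives the limit:
gradient norms converge and values converge almost everywhere. -/
theorem HasRadialGradient.sq_le (hN : 3 ≤ N) {R : ℝ} (hR : 0 < R) :
    ∃ C, 0 < C ∧ ∀ (u : EuclideanSpace ℝ (Fin N) → ℝ)
      (G : EuclideanSpace ℝ (Fin N) → EuclideanSpace ℝ (Fin N)), HasRadialGradient u G →
      ∀ᵐ x, R ≤ ‖x‖ → u x ^ 2 ≤ C * normD u ^ 2 := by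
  obtain ⟨C, hC, h⟩ := IsRadialTest.abs_le hN hR
  refine ⟨C, hC, fun u G hu => ?_⟩
  obtain ⟨φ, hφ, -, hφG, hae⟩ := hu.exists_seq hN
  have hsq : ∀ {K : EuclideanSpace ℝ (Fin N) → EuclideanSpace ℝ (Fin N)}, MemLp K 2 volume →
      ∫ y, ‖K y‖ ^ 2 = (eLpNorm K 2 volume).toReal ^ 2 := by
    intro K hK
    rw [hK.eLpNorm_eq_integral_rpow_norm two_ne_zero ENNReal.ofNat_ne_top,
      ENNReal.toReal_ofReal (by positivity), ← Real.rpow_natCast, ← Real.rpow_mul (by positivity)]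
    simp
  have hn : Tendsto (fun n => eLpNorm (gradient (φ n)) 2 volume) atTop
      (𝓝 (eLpNorm G 2 volume)) := by
    have hG := hu.2.2.1
    refine tendsto_of_tendsto_of_tendsto_of_le_of_le
      (g := fun n => eLpNorm G 2 volume - eLpNorm (fun x => gradient (φ n) x - G x) 2 volume)
      (h := fun n => eLpNorm G 2 volume + eLpNorm (fun x => gradient (φ n) x - G x) 2 volume)
      ?_ ?_ (fun n => ?_) (fun n => ?_)
    · simpa using ENNReal.Tendsto.sub tendsto_const_nhds hφG (Or.inl hG.2.ne)
    · simpa using tendsto_const_nhds.add hφG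
    · rw [tsub_le_iff_right]
      have := eLpNorm_sub_le (p := 2) ((hφ n).1.memLp_gradient 2).1
        (((hφ n).1.memLp_gradient 2).sub hG).1 one_le_two
      rwa [sub_sub_cancel] at this
    · have := eLpNorm_add_le (p := 2) hG.1
        (((hφ n).1.memLp_gradient 2).sub hG).1 one_le_two
      rwa [add_sub_cancel] at this
  have hn2 : Tendsto (fun n => C * ∫ y, ‖gradient (φ n) y‖ ^ 2) atTop (𝓝 (C * normD u ^ 2)) := by
    rw [hu.normD_eq, Real.sq_sqrt (integral_nonneg fun _ => sq_nonneg _), hsq hu.2.2.1]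
    simp only [fun n => hsq ((hφ n).1.memLp_gradient 2)]
    exact (((ENNReal.tendsto_toReal hu.2.2.1.2.ne).comp hn).pow 2).const_mul C
  filter_upwards [hae] with x hx hxR
  exact le_of_tendsto_of_tendsto' (hx.pow 2) hn2 fun n => h _ (hφ n) x hxR

end RadialBound

/-! ### The norm of `E` and integrability against the potentials -/

section Potentials

variable {N : ℕ}

theorem ae_norm_pos (hN : 3 ≤ N) : ∀ᵐ x : EuclideanSpace ℝ (Fin N), 0 < ‖x‖ := by
  have : Nonempty (Fin N) := ⟨⟨0, by omega⟩⟩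
  filter_upwards [measure_eq_zero_iff_ae_notMem.1
    (measure_singleton (μ := volume) (0 : EuclideanSpace ℝ (Fin N)))] with x hx
  exact norm_pos_iff.2 hx

theorem aestronglyMeasurable_radial (hN : 3 ≤ N) {V : ℝ → ℝ} (hV : ContinuousOn V (Set.Ioi 0)) :
    AEStronglyMeasurable (fun x : EuclideanSpace ℝ (Fin N) => V ‖x‖) volume := by
  have hs : MeasurableSet {x : EuclideanSpace ℝ (Fin N) | 0 < ‖x‖} :=
    measurableSet_lt measurable_const measurable_norm
  have h1 : ContinuousOn (fun x : EuclideanSpace ℝ (Fin N) => V ‖x‖) {x | 0 < ‖x‖} :=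
    hV.comp continuous_norm.continuousOn fun x hx => hx
  have h2 := h1.aestronglyMeasurable (μ := volume) hs
  have h3 : (volume : Measure (EuclideanSpace ℝ (Fin N))).restrict {x | 0 < ‖x‖} = volume :=
    Measure.restrict_eq_self_of_ae_mem (ae_norm_pos hN)
  rwa [h3] at h2

/-- Reparametrise the infimum by `k ↦ k / c`. -/
theorem normO_const_mul (V : ℝ → ℝ) (u : EuclideanSpace ℝ (Fin N) → ℝ) {c : ℝ} (hc : 0 < c) :
    normO V (fun x => c * u x) = c * normO V u := by
  rw [normO, normO, Real.mul_iInf_of_nonneg hc.le]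
  have hsurj : Function.Surjective
      (fun k : Set.Ioi (0 : ℝ) => (⟨k / c, div_pos k.2 hc⟩ : Set.Ioi (0 : ℝ))) := fun k =>
    ⟨⟨k * c, mul_pos k.2 hc⟩, Subtype.ext (mul_div_cancel_right₀ _ hc.ne')⟩
  rw [← hsurj.iInf_comp]
  refine iInf_congr fun k => ?_
  have e : ∀ x, (k : ℝ) / c * (c * u x) = k * u x := fun x => by field_simp
  simp only [e, one_div_div]
  ring

theorem normO_nonneg (hN : 3 ≤ N) {V : ℝ → ℝ} (hV : ∀ r, 0 < r → 0 ≤ V r)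
    (u : EuclideanSpace ℝ (Fin N) → ℝ) : 0 ≤ normO V u := by
  refine Real.iInf_nonneg fun k => ?_
  have h : 0 ≤ ∫ x, V ‖x‖ * changeVar ((k : ℝ) * u x) ^ 2 := by
    refine integral_nonneg_of_ae ?_
    filter_upwards [ae_norm_pos hN] with x hx
    exact mul_nonneg (hV _ hx) (sq_nonneg _)
  have hk : 0 < (k : ℝ) := k.2
  positivity

theorem normE_nonneg (hN : 3 ≤ N) {V : ℝ → ℝ} (hV : ∀ r, 0 < r → 0 ≤ V r)
    (u : EuclideanSpace ℝ (Fin N) → ℝ) : 0 ≤ normE V u :=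
  add_nonneg (Real.sqrt_nonneg _) (normO_nonneg hN hV u)

theorem HasRadialGradient.normE_const_mul (hN : 3 ≤ N) (V : ℝ → ℝ)
    {u : EuclideanSpace ℝ (Fin N) → ℝ}
    {G : EuclideanSpace ℝ (Fin N) → EuclideanSpace ℝ (Fin N)} (hu : HasRadialGradient u G)
    {c : ℝ} (hc : 0 < c) : normE V (fun x => c * u x) = c * normE V u := by
  have h : normD (fun x => c * u x) = c * normD u := by
    rw [(hu.const_mul hN c).normD_eq, hu.normD_eq]
    simp only [norm_smul, mul_pow, integral_const_mul, Real.norm_eq_abs, sq_abs]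
    rw [Real.sqrt_mul (sq_nonneg c), Real.sqrt_sq hc.le]
  rw [normE, normE, h, normO_const_mul V u hc, mul_add]

theorem MemE.const_mul (hN : 3 ≤ N) {V : ℝ → ℝ} (hVc : ContinuousOn V (Set.Ioi 0))
    (hV : ∀ r, 0 < r → 0 ≤ V r) {u : EuclideanSpace ℝ (Fin N) → ℝ} (hu : MemE V u) {c : ℝ}
    (hc : 0 < c) : MemE V (fun x => c * u x) := by
  obtain ⟨G, hG⟩ := memD_iff.1 hu.1
  refine ⟨memD_iff.2 ⟨_, hG.const_mul hN c⟩, ?_⟩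
  refine (hu.2.const_mul (max 1 c ^ 2)).mono' ((aestronglyMeasurable_radial hN hVc).mul
    ((continuous_changeVar.comp_aestronglyMeasurable (hG.1.1.const_mul c)).pow 2)) ?_
  filter_upwards [ae_norm_pos hN] with x hx
  rw [Real.norm_of_nonneg (mul_nonneg (hV _ hx) (sq_nonneg _)), mul_left_comm]
  exact mul_le_mul_of_nonneg_left (changeVar_mul_sq_le hc _) (hV _ hx)

/-- The decay estimate makes `u` vanish outside every ball of radius `1 / (n + 1)`. This covers the
case in which normalising to the unit sphere of `E` is impossible. -/
theorem HasRadialGradient.ae_eq_zero_of_normD_eq_zero (hN : 3 ≤ N)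
    {u : EuclideanSpace ℝ (Fin N) → ℝ}
    {G : EuclideanSpace ℝ (Fin N) → EuclideanSpace ℝ (Fin N)} (hu : HasRadialGradient u G)
    (h0 : normD u = 0) : ∀ᵐ x, u x = 0 := by
  have h : ∀ n : ℕ, ∀ᵐ x : EuclideanSpace ℝ (Fin N), 1 / ((n : ℝ) + 1) ≤ ‖x‖ → u x = 0 := by
    intro n
    obtain ⟨C, -, hC⟩ := HasRadialGradient.sq_le hN (R := 1 / ((n : ℝ) + 1)) (by positivity)
    filter_upwards [hC u G hu] with x hx hxn
    have := hx hxn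
    rw [h0] at this
    exact pow_eq_zero_iff two_ne_zero |>.1 (le_antisymm (by simpa using this) (sq_nonneg _))
  filter_upwards [ae_all_iff.2 h, ae_norm_pos hN] with x hx hx0
  obtain ⟨n, hn⟩ := exists_nat_one_div_lt hx0
  exact hx n hn.le

/-- Both sides are homogeneous: rescale `u` to norm one, apply the finite supremum, and undo the
factor `c ^ q`. -/
theorem integrableOn_of_iSup_lt_top (hN : 3 ≤ N) {V K : ℝ → ℝ} (hVK : HypH V K) {q : ℝ}
    (hq : 1 < q) {s : Set (EuclideanSpace ℝ (Fin N))}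
    (hS : ⨆ (u : EuclideanSpace ℝ (Fin N) → ℝ) (_ : MemE V u ∧ normE V u = 1),
      ∫⁻ x in s, ENNReal.ofReal (K ‖x‖ * |u x| ^ q) < ⊤)
    {u : EuclideanSpace ℝ (Fin N) → ℝ} (hu : MemE V u) :
    IntegrableOn (fun x => K ‖x‖ * |u x| ^ q) s volume := by
  obtain ⟨G, hG⟩ := memD_iff.1 hu.1
  have hmeas : ∀ {w : EuclideanSpace ℝ (Fin N) → ℝ}, AEStronglyMeasurable w volume →
      AEStronglyMeasurable (fun x => K ‖x‖ * |w x| ^ q) volume := fun hw =>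
    (aestronglyMeasurable_radial hN hVK.K_cont).mul
      ((Real.continuous_rpow_const (by linarith)).comp_aestronglyMeasurable hw.norm)
  rcases (normE_nonneg hN hVK.V_nonneg u).eq_or_lt with h0 | hpos
  · have hD : normD u = 0 := by
      have h1 : 0 ≤ normD u := Real.sqrt_nonneg _
      have h2 := normO_nonneg hN hVK.V_nonneg u
      rw [normE] at h0
      linarith
    refine (integrable_zero _ _ _).congr (ae_restrict_of_ae ?_)
    filter_upwards [hG.ae_eq_zero_of_normD_eq_zero hN hD] with x hx
    simp [hx, Real.zero_rpow (by linarith : q ≠ 0)]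
  · set c := (normE V u)⁻¹ with hc
    have hc0 : 0 < c := inv_pos.2 hpos
    have hcE : MemE V (fun x => c * u x) := hu.const_mul hN hVK.V_cont hVK.V_nonneg hc0
    have hc1 : normE V (fun x => c * u x) = 1 := by
      rw [hG.normE_const_mul hN V hc0, hc, inv_mul_cancel₀ hpos.ne']
    have hfin : ∫⁻ x in s, ENNReal.ofReal (K ‖x‖ * |c * u x| ^ q) < ⊤ :=
      (le_iSup₂ (f := fun (u : EuclideanSpace ℝ (Fin N) → ℝ) (_ : MemE V u ∧ normE V u = 1) =>
        ∫⁻ x in s, ENNReal.ofReal (K ‖x‖ * |u x| ^ q)) (fun x => c * u x) ⟨hcE, hc1⟩).trans_lt hS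
    have hint : IntegrableOn (fun x => K ‖x‖ * |c * u x| ^ q) s volume := by
      refine ⟨(hmeas (hG.1.1.const_mul c)).restrict, ?_⟩
      rw [hasFiniteIntegral_iff_ofReal]
      · exact hfin
      · refine ae_restrict_of_ae ?_
        filter_upwards [ae_norm_pos hN] with x hx
        exact mul_nonneg (hVK.K_pos _ hx).le (Real.rpow_nonneg (abs_nonneg _) _)
    refine (hint.const_mul (c ^ q)⁻¹).congr (Eventually.of_forall fun x => ?_)
    have : (c ^ q) ≠ 0 := (Real.rpow_pos_of_pos hc0 q).ne'
    simp only [abs_mul, abs_of_pos hc0, Real.mul_rpow hc0.le (abs_nonneg _)]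
    field_simp

theorem add_rpow_le_two_rpow_mul {a b q : ℝ} (ha : 0 ≤ a) (hb : 0 ≤ b) (hq : 0 ≤ q) :
    (a + b) ^ q ≤ 2 ^ q * (a ^ q + b ^ q) := by
  have ha' := Real.rpow_nonneg ha q
  have hb' := Real.rpow_nonneg hb q
  have h2 := Real.rpow_nonneg (zero_le_two (α := ℝ)) q
  rcases le_total a b with h | h
  · calc (a + b) ^ q ≤ (2 * b) ^ q := Real.rpow_le_rpow (by positivity) (by linarith) hq
      _ = 2 ^ q * b ^ q := Real.mul_rpow (by positivity) hb
      _ ≤ _ := mul_le_mul_of_nonneg_left (by linarith) h2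
  · calc (a + b) ^ q ≤ (2 * a) ^ q := Real.rpow_le_rpow (by positivity) (by linarith) hq
      _ = 2 ^ q * a ^ q := Real.mul_rpow (by positivity) ha
      _ ≤ _ := mul_le_mul_of_nonneg_left (by linarith) h2

theorem integrableOn_add_rpow (hN : 3 ≤ N) {V K : ℝ → ℝ} (hVK : HypH V K) {q : ℝ}
    (hq : 1 < q) {s : Set (EuclideanSpace ℝ (Fin N))}
    (hS : ⨆ (u : EuclideanSpace ℝ (Fin N) → ℝ) (_ : MemE V u ∧ normE V u = 1),
      ∫⁻ x in s, ENNReal.ofReal (K ‖x‖ * |u x| ^ q) < ⊤)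
    {u v : EuclideanSpace ℝ (Fin N) → ℝ} (hu : MemE V u) (hv : MemE V v) :
    IntegrableOn (fun x => K ‖x‖ * (|u x| + |v x|) ^ q) s volume := by
  have hi := ((integrableOn_of_iSup_lt_top hN hVK hq hS hu).add
    (integrableOn_of_iSup_lt_top hN hVK hq hS hv)).const_mul (2 ^ q)
  refine hi.mono' (((aestronglyMeasurable_radial hN hVK.K_cont).mul
    ((Real.continuous_rpow_const (by linarith)).comp_aestronglyMeasurable
      (hu.1.1.1.norm.add hv.1.1.1.norm))).restrict) (ae_restrict_of_ae ?_)
  filter_upwards [ae_norm_pos hN] with x hx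
  have hK := (hVK.K_pos _ hx).le
  rw [Real.norm_of_nonneg (by positivity)]
  calc K ‖x‖ * (|u x| + |v x|) ^ q ≤ K ‖x‖ * (2 ^ q * (|u x| ^ q + |v x| ^ q)) :=
        mul_le_mul_of_nonneg_left
          (add_rpow_le_two_rpow_mul (abs_nonneg _) (abs_nonneg _) (by linarith)) hK
    _ = _ := by simp only [Pi.add_apply]; ring

/-- Elements of `D_r^{1,2}` are bounded away from the origin. -/
theorem MemD.exists_abs_le (hN : 3 ≤ N) {u : EuclideanSpace ℝ (Fin N) → ℝ} (hu : MemD u) {R : ℝ}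
    (hR : 0 < R) : ∃ M, 0 ≤ M ∧ ∀ᵐ x, R ≤ ‖x‖ → |u x| ≤ M := by
  obtain ⟨G, hG⟩ := memD_iff.1 hu
  obtain ⟨C, hC, h⟩ := HasRadialGradient.sq_le hN hR
  refine ⟨√(C * normD u ^ 2), Real.sqrt_nonneg _, ?_⟩
  filter_upwards [h u G hG] with x hx hxR
  exact Real.abs_le_sqrt (hx hxR)

/-- Use the power `q₁` inside `B_{R₁}` and `q₂` outside `B_{R₂}`. If an annulus remains between
them, `u` and `v` are bounded there by radial decay and `K` by compactness. The sum `|u| + |v|`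
dominates `|u + t v|` for all `|t| ≤ 1`. -/
theorem integrable_mul_min (hN : 3 ≤ N) {V K : ℝ → ℝ} (hVK : HypH V K) {q₁ q₂ : ℝ}
    (hq₁ : 1 < q₁) (hq₂ : 1 < q₂) (hS : HypS N V K q₁ q₂)
    {u v : EuclideanSpace ℝ (Fin N) → ℝ} (hu : MemE V u) (hv : MemE V v) :
    Integrable (fun x => K ‖x‖ * min ((|u x| + |v x|) ^ q₁) ((|u x| + |v x|) ^ q₂)) volume := by
  obtain ⟨R₁, R₂, hR₁, hR₂, hS1, hS2⟩ := hS
  have hm : ∀ {q : ℝ}, 1 < q →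
      AEStronglyMeasurable (fun x => (|u x| + |v x|) ^ q) volume := fun hq =>
    (Real.continuous_rpow_const (by linarith)).comp_aestronglyMeasurable
      (hu.1.1.1.norm.add hv.1.1.1.norm)
  have hmeas : AEStronglyMeasurable
      (fun x => K ‖x‖ * min ((|u x| + |v x|) ^ q₁) ((|u x| + |v x|) ^ q₂)) volume :=
    (aestronglyMeasurable_radial hN hVK.K_cont).mul
      (continuous_min.comp_aestronglyMeasurable ((hm hq₁).prodMk (hm hq₂)))
  have i1 : IntegrableOn (fun x => K ‖x‖ * min ((|u x| + |v x|) ^ q₁) ((|u x| + |v x|) ^ q₂))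
      (Metric.ball 0 R₁) volume := by
    refine (integrableOn_add_rpow hN hVK hq₁ hS1 hu hv).mono' hmeas.restrict (ae_restrict_of_ae ?_)
    filter_upwards [ae_norm_pos hN] with x hx
    have hK := (hVK.K_pos _ hx).le
    rw [Real.norm_of_nonneg (by positivity)]
    exact mul_le_mul_of_nonneg_left (min_le_left _ _) hK
  have i2 : IntegrableOn (fun x => K ‖x‖ * min ((|u x| + |v x|) ^ q₁) ((|u x| + |v x|) ^ q₂))
      (Metric.ball 0 R₂)ᶜ volume := by
    refine (integrableOn_add_rpow hN hVK hq₂ hS2 hu hv).mono' hmeas.restrict (ae_restrict_of_ae ?_)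
    filter_upwards [ae_norm_pos hN] with x hx
    have hK := (hVK.K_pos _ hx).le
    rw [Real.norm_of_nonneg (by positivity)]
    exact mul_le_mul_of_nonneg_left (min_le_right _ _) hK
  have i3 : IntegrableOn (fun x => K ‖x‖ * min ((|u x| + |v x|) ^ q₁) ((|u x| + |v x|) ^ q₂))
      (Metric.closedBall 0 R₂ \ Metric.ball 0 R₁) volume := by
    obtain ⟨M, hM0, hM⟩ := hu.1.exists_abs_le hN hR₁
    obtain ⟨M', hM'0, hM'⟩ := hv.1.exists_abs_le hN hR₁
    obtain ⟨A, hA⟩ := isCompact_Icc.exists_bound_of_continuousOn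
      (hVK.K_cont.mono fun (r : ℝ) (hr : r ∈ Set.Icc R₁ R₂) => hR₁.trans_le hr.1)
    have hfin : volume (Metric.closedBall (0 : EuclideanSpace ℝ (Fin N)) R₂ \ Metric.ball 0 R₁)
        < ⊤ := (measure_mono Set.sdiff_subset).trans_lt measure_closedBall_lt_top
    refine Integrable.mono' (g := fun _ => A * (M + M') ^ q₁)
      (integrableOn_const hfin.ne) hmeas.restrict ?_
    filter_upwards [ae_restrict_of_ae hM, ae_restrict_of_ae hM', ae_restrict_mem
      (Metric.isClosed_closedBall.measurableSet.diff Metric.isOpen_ball.measurableSet)]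
      with x hx hx' hxs
    have hx1 : R₁ ≤ ‖x‖ := by simpa using hxs.2
    have hx2 : ‖x‖ ≤ R₂ := by simpa using hxs.1
    have hq0 : 0 ≤ q₁ := by linarith
    rw [norm_mul, Real.norm_of_nonneg (show 0 ≤ min _ _ by positivity)]
    refine mul_le_mul (hA _ ⟨hx1, hx2⟩) ((min_le_left _ _).trans (Real.rpow_le_rpow (by positivity)
      (add_le_add (hx hx1) (hx' hx1)) hq0)) (by positivity)
      ((norm_nonneg _).trans (hA _ ⟨hx1, hx2⟩))
  have hU : Metric.ball (0 : EuclideanSpace ℝ (Fin N)) R₁ ∪ (Metric.ball 0 R₂)ᶜ ∪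
      (Metric.closedBall 0 R₂ \ Metric.ball 0 R₁) = Set.univ := by
    ext x
    simp only [Set.mem_union, Metric.mem_ball, dist_zero_right, Set.mem_compl_iff, Set.mem_sdiff,
      Metric.mem_closedBall, Set.mem_univ, iff_true]
    by_cases h1 : ‖x‖ < R₁
    · exact Or.inl (Or.inl h1)
    · by_cases h2 : ‖x‖ < R₂
      · exact Or.inr ⟨h2.le, h1⟩
      · exact Or.inl (Or.inr h2)
  rw [← integrableOn_univ, ← hU]
  exact (i1.union i2).union i3

/-- In polar coordinates the density near the origin is `y ^ (N - 1) * V y ≤ y ^ 2 * V y ≤ C`, which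
uses `N ≥ 3`. -/
theorem integrable_potential_mul_sq (hN : 3 ≤ N) {V K : ℝ → ℝ} (hVK : HypH V K)
    {h : EuclideanSpace ℝ (Fin N) → ℝ} (hc : Continuous h) (hs : HasCompactSupport h) :
    Integrable (fun x => V ‖x‖ * h x ^ 2) volume := by
  have : Nonempty (Fin N) := ⟨⟨0, by omega⟩⟩
  have : Nontrivial (EuclideanSpace ℝ (Fin N)) := inferInstance
  obtain ⟨A, hA⟩ := hc.bounded_above_of_compact_support hs
  obtain ⟨M, hM⟩ := hs.isCompact.isBounded.subset_closedBall (0 : EuclideanSpace ℝ (Fin N))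
  obtain ⟨C, hC0, hC⟩ := hVK.V_bound
  have hc1 : ContinuousOn (fun y => y ^ (N - 1) * V y) (Set.Ioi 0) :=
    (continuous_pow _).continuousOn.mul hVK.V_cont
  have i1 : IntegrableOn (fun y => y ^ (N - 1) * V y) (Set.Ioo 0 1) volume := by
    refine Integrable.mono' (g := fun _ => C) (integrableOn_const (by simp))
      ((hc1.mono fun y hy => hy.1).aestronglyMeasurable measurableSet_Ioo) ?_
    filter_upwards [ae_restrict_mem measurableSet_Ioo] with y hy
    have hV := hVK.V_nonneg y hy.1
    have hy0 := hy.1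
    rw [Real.norm_of_nonneg (by positivity)]
    have h1 := hC y hy.1 hy.2
    rw [le_div_iff₀ (by positivity)] at h1
    calc y ^ (N - 1) * V y ≤ y ^ 2 * V y := mul_le_mul_of_nonneg_right
          (pow_le_pow_of_le_one hy0.le hy.2.le (by omega)) hV
      _ ≤ C := by linarith
  have i2 : IntegrableOn (fun y => y ^ (N - 1) * V y) (Set.Icc 1 M) volume :=
    (hc1.mono fun y hy => one_pos.trans_le hy.1).integrableOn_Icc
  -- Truncating `V` at a radius `M` beyond which `h` vanishes keeps the function radial, so polar
  -- coordinates apply.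
  have i3 : IntegrableOn (fun y => y ^ (N - 1) * (Set.Iic M).indicator V y) (Set.Ioi 0) volume := by
    have e : (fun y => y ^ (N - 1) * (Set.Iic M).indicator V y)
        = (Set.Iic M).indicator fun y => y ^ (N - 1) * V y := by
      ext y
      by_cases hy : y ∈ Set.Iic M <;> simp [hy]
    rw [e, IntegrableOn, integrable_indicator_iff measurableSet_Iic, IntegrableOn,
      Measure.restrict_restrict measurableSet_Iic]
    refine (i1.union i2).mono_set fun y hy => ?_
    rcases lt_or_ge y 1 with h1 | h1
    · exact Or.inl ⟨hy.2, h1⟩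
    · exact Or.inr ⟨h1, hy.1⟩
  have i4 : Integrable (fun x : EuclideanSpace ℝ (Fin N) => (Set.Iic M).indicator V ‖x‖)
      volume := by
    rw [integrable_fun_norm_addHaar, finrank_euclideanSpace_fin]
    exact i3
  refine (i4.norm.const_mul (A ^ 2)).mono' ((aestronglyMeasurable_radial hN hVK.V_cont).mul
    (hc.pow 2).aestronglyMeasurable) (Eventually.of_forall fun x => ?_)
  by_cases hx : x ∈ tsupport h
  · have hxM : ‖x‖ ≤ M := by simpa using hM hx
    rw [Set.indicator_of_mem (show ‖x‖ ∈ Set.Iic M from hxM), norm_mul, mul_comm, norm_pow]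
    exact mul_le_mul_of_nonneg_right (pow_le_pow_left₀ (norm_nonneg _) (hA x) 2) (norm_nonneg _)
  · rw [image_eq_zero_of_notMem_tsupport hx]
    simp only [ne_eq, OfNat.ofNat_ne_zero, not_false_eq_true, zero_pow, mul_zero, norm_zero]
    positivity

/-- The identity `(1 / f')² = 1 + 2 f²` splits the integrand into `V h²` and a bounded multiple of
`V f(u)²`. -/
theorem MemE.integrable_potential_mul_sq (hN : 3 ≤ N) {V K : ℝ → ℝ} (hVK : HypH V K)
    {u h : EuclideanSpace ℝ (Fin N) → ℝ} (hu : MemE V u) (hh : IsRadialTest h) :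
    Integrable (fun x => V ‖x‖ * (h x * invDeriv (u x)) ^ 2) volume := by
  obtain ⟨A, hA⟩ := hh.1.1.continuous.bounded_above_of_compact_support hh.1.2
  have i1 := QuasilinearSchrodinger.integrable_potential_mul_sq hN hVK hh.1.1.continuous hh.1.2
  have i2 : Integrable (fun x => (2 * h x ^ 2) * (V ‖x‖ * changeVar (u x) ^ 2)) volume := by
    refine hu.2.bdd_mul (c := 2 * A ^ 2)
      ((hh.1.1.continuous.pow 2).const_mul 2).aestronglyMeasurable
      (Eventually.of_forall fun x => ?_)
    rw [norm_mul, norm_pow, Real.norm_two]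
    gcongr
    exact hA x
  refine (i1.add i2).congr (Eventually.of_forall fun x => ?_)
  simp only [Pi.add_apply, mul_pow, invDeriv_sq]
  ring

theorem MemE.mul_invDeriv (hN : 3 ≤ N) {V K : ℝ → ℝ} (hVK : HypH V K)
    {u h : EuclideanSpace ℝ (Fin N) → ℝ} (hu : MemE V u) (hh : IsRadialTest h) :
    MemE V (fun x => h x * invDeriv (u x)) := by
  obtain ⟨G, hG⟩ := memD_iff.1 hu.1
  have hv := hG.mul_invDeriv hN hh
  refine ⟨memD_iff.2 ⟨_, hv⟩, (hu.integrable_potential_mul_sq hN hVK hh).mono'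
    ((aestronglyMeasurable_radial hN hVK.V_cont).mul
      ((continuous_changeVar.comp_aestronglyMeasurable hv.1.1).pow 2)) ?_⟩
  filter_upwards [ae_norm_pos hN] with x hx
  have hV := hVK.V_nonneg _ hx
  rw [Real.norm_of_nonneg (by positivity)]
  exact mul_le_mul_of_nonneg_left (sq_le_sq.2 (abs_changeVar_le _)) hV

end Potentials

/-! ### Directional derivatives of the energy -/

section Derivative

variable {N : ℕ}

theorem hasDerivAt_integral_weight {α : Type*} [MeasurableSpace α] {μ : Measure α}
    {W u v bound : α → ℝ} {P P' : ℝ → ℝ} (hW : AEStronglyMeasurable W μ)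
    (hu : AEStronglyMeasurable u μ) (hv : AEStronglyMeasurable v μ)
    (hP : ∀ s, HasDerivAt P (P' s) s) (hP' : Continuous P')
    (h0 : Integrable (fun x => W x * P (u x)) μ) (hbound : Integrable bound μ)
    (hb : ∀ᵐ x ∂μ, ∀ t ∈ Metric.ball (0 : ℝ) 1, ‖W x * (P' (u x + t * v x) * v x)‖ ≤ bound x) :
    Integrable (fun x => W x * (P' (u x) * v x)) μ ∧
      HasDerivAt (fun t => ∫ x, W x * P (u x + t * v x) ∂μ)
        (∫ x, W x * (P' (u x) * v x) ∂μ) 0 := by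
  have hPc : Continuous P := continuous_iff_continuousAt.2 fun s => (hP s).continuousAt
  have key := hasDerivAt_integral_of_dominated_loc_of_deriv_le (μ := μ)
    (F := fun t x => W x * P (u x + t * v x)) (F' := fun t x => W x * (P' (u x + t * v x) * v x))
    (x₀ := (0 : ℝ)) (Metric.ball_mem_nhds 0 one_pos)
    (Eventually.of_forall fun t => hW.mul (hPc.comp_aestronglyMeasurable (hu.add (hv.const_mul t))))
    (by simpa using h0)
    (hW.mul ((hP'.comp_aestronglyMeasurable (hu.add (hv.const_mul 0))).mul hv)) hb hbound
    (Eventually.of_forall fun x t _ => by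
      have h1 : HasDerivAt (fun t => u x + t * v x) (v x) t := by
        simpa using ((hasDerivAt_id t).mul_const (v x)).const_add (u x)
      exact ((hP _).comp t h1).const_mul (W x))
  simpa using key

theorem hasDerivAt_changeVar_sq (s : ℝ) :
    HasDerivAt (fun s => changeVar s ^ 2) (2 * changeVar s / invDeriv s) s := by
  refine ((hasDerivAt_changeVar' s).pow 2).congr_deriv ?_
  simp only [Nat.cast_ofNat, Nat.add_one_sub_one, pow_one]
  ring

theorem hasDerivAt_primG {g : ℝ → ℝ} (hg : Continuous g) (t : ℝ) :
    HasDerivAt (primG g) (g t) t :=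
  intervalIntegral.integral_hasDerivAt_right (hg.intervalIntegrable _ _)
    (hg.stronglyMeasurableAtFilter _ _) hg.continuousAt

theorem hasDerivAt_primG_comp {g : ℝ → ℝ} (hg : Continuous g) (s : ℝ) :
    HasDerivAt (fun s => primG g (changeVar s)) (g (changeVar s) / invDeriv s) s := by
  refine ((hasDerivAt_primG hg _).comp s (hasDerivAt_changeVar' s)).congr_deriv ?_
  ring

theorem abs_changeVar_div_le (s : ℝ) (y : ℝ) : |y / invDeriv s| ≤ |y| := by
  rw [abs_div, abs_of_pos (invDeriv_pos s)]
  exact div_le_self (abs_nonneg _) (one_le_invDeriv s)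

/-- For `|t| ≤ 1` the derivative of `f(u + t v)²` in `t` is at most `2 (|f(u)| + |v|) |v| ≤ f(u)² +
3 v²`. Integrability of `V v²` supplies the majorant; membership `v ∈ E` controls only `V f(v)²`. -/
theorem hasDerivAt_integral_potential (hN : 3 ≤ N) {V K : ℝ → ℝ} (hVK : HypH V K)
    {u v : EuclideanSpace ℝ (Fin N) → ℝ} (hu : MemE V u) (hv : MemE V v)
    (hv2 : Integrable (fun x => V ‖x‖ * v x ^ 2) volume) :
    Integrable (fun x => V ‖x‖ * (2 * changeVar (u x) / invDeriv (u x) * v x)) volume ∧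
      HasDerivAt (fun t => ∫ x, V ‖x‖ * changeVar (u x + t * v x) ^ 2)
        (∫ x, V ‖x‖ * (2 * changeVar (u x) / invDeriv (u x) * v x)) 0 := by
  refine hasDerivAt_integral_weight (P := fun s => changeVar s ^ 2)
    (P' := fun s => 2 * changeVar s / invDeriv s) (aestronglyMeasurable_radial hN hVK.V_cont)
    hu.1.1.1 hv.1.1.1 hasDerivAt_changeVar_sq ((continuous_changeVar.const_mul 2).div₀
      continuous_invDeriv fun s => (invDeriv_pos s).ne') hu.2 (hu.2.add (hv2.const_mul 3)) ?_
  filter_upwards [ae_norm_pos hN] with x hx t ht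
  have hV := hVK.V_nonneg _ hx
  have ht1 : |t| ≤ 1 := by
    have : |t| < 1 := by simpa using ht
    exact this.le
  rw [norm_mul, Real.norm_of_nonneg hV, norm_mul]
  have h1 : |2 * changeVar (u x + t * v x) / invDeriv (u x + t * v x)|
      ≤ 2 * (|changeVar (u x)| + |v x|) := by
    refine (abs_changeVar_div_le _ _).trans ?_
    rw [abs_mul, abs_two]
    have h2 := abs_sub_le_of_abs_deriv_le differentiable_changeVar abs_deriv_changeVar_le
      (u x + t * v x) (u x)
    have h3 : |t * v x| ≤ |v x| := by
      rw [abs_mul]; exact mul_le_of_le_one_left (abs_nonneg _) ht1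
    rw [add_sub_cancel_left, one_mul] at h2
    have h4 := abs_sub_abs_le_abs_sub (changeVar (u x + t * v x)) (changeVar (u x))
    linarith
  have h5 : |2 * changeVar (u x + t * v x) / invDeriv (u x + t * v x)| * |v x|
      ≤ changeVar (u x) ^ 2 + 3 * v x ^ 2 := by
    refine (mul_le_mul_of_nonneg_right h1 (abs_nonneg _)).trans ?_
    rw [← sq_abs (changeVar (u x)), ← sq_abs (v x)]
    nlinarith [sq_nonneg (|changeVar (u x)| - |v x|)]
  calc V ‖x‖ * (|2 * changeVar (u x + t * v x) / invDeriv (u x + t * v x)| * |v x|)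
      ≤ V ‖x‖ * (changeVar (u x) ^ 2 + 3 * v x ^ 2) := mul_le_mul_of_nonneg_left h5 hV
    _ = _ := by simp only [Pi.add_apply]; ring

theorem abs_mul_le_of_growth {g : ℝ → ℝ} {q₁ q₂ C : ℝ} (hq₁ : 1 < q₁) (hq₂ : 1 < q₂) (hC : 0 ≤ C)
    (hg : ∀ t, |g t| ≤ C * min (|t| ^ (q₁ - 1)) (|t| ^ (q₂ - 1))) {t b m : ℝ} (ht : |t| ≤ m)
    (hb : |b| ≤ m) : |g t| * |b| ≤ C * min (m ^ q₁) (m ^ q₂) := by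
  have hm : 0 ≤ m := (abs_nonneg t).trans ht
  have hpow : ∀ {q : ℝ}, 1 < q → |t| ^ (q - 1) * |b| ≤ m ^ q := fun {q} hq => by
    have h1 : m ^ q = m ^ (q - 1) * m := by
      rw [← Real.rpow_add_one' hm (by linarith), sub_add_cancel]
    rw [h1]
    have hq0 : 0 ≤ q - 1 := by linarith
    exact mul_le_mul (Real.rpow_le_rpow (abs_nonneg _) ht hq0) hb (abs_nonneg _)
      (Real.rpow_nonneg hm _)
  calc |g t| * |b| ≤ C * min (|t| ^ (q₁ - 1)) (|t| ^ (q₂ - 1)) * |b| :=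
        mul_le_mul_of_nonneg_right (hg t) (abs_nonneg _)
    _ = C * min (|t| ^ (q₁ - 1) * |b|) (|t| ^ (q₂ - 1) * |b|) := by
        rw [mul_assoc, min_mul_of_nonneg _ _ (abs_nonneg b)]
    _ ≤ _ := mul_le_mul_of_nonneg_left (min_le_min (hpow hq₁) (hpow hq₂)) hC

/-- The condition with `θ > 2` gives `G ≥ 0`, hence `G ≤ 2θG ≤ g(t) t`; the growth bound on `g`
thereby also controls `G`. -/
theorem abs_primG_le {g : ℝ → ℝ} {q₁ q₂ : ℝ} (hg : HypG g q₁ q₂) (t : ℝ) :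
    |primG g t| ≤ |g t| * |t| := by
  obtain ⟨θ, hθ, h⟩ := hg.g1
  obtain ⟨h1, h2⟩ := h t
  have h0 : 0 ≤ primG g t := by
    by_contra! hneg
    nlinarith
  rw [abs_of_nonneg h0, ← abs_mul]
  refine le_trans ?_ (le_abs_self _)
  nlinarith

theorem hasDerivAt_integral_nonlinearity (hN : 3 ≤ N) {V K g : ℝ → ℝ} {q₁ q₂ : ℝ}
    (hq₁ : 1 < q₁) (hq₂ : 1 < q₂) (hVK : HypH V K) (hg : HypG g q₁ q₂) (hS : HypS N V K q₁ q₂)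
    {u v : EuclideanSpace ℝ (Fin N) → ℝ} (hu : MemE V u) (hv : MemE V v) :
    Integrable (fun x => K ‖x‖ * (g (changeVar (u x)) / invDeriv (u x) * v x)) volume ∧
      HasDerivAt (fun t => ∫ x, K ‖x‖ * primG g (changeVar (u x + t * v x)))
        (∫ x, K ‖x‖ * (g (changeVar (u x)) / invDeriv (u x) * v x)) 0 := by
  obtain ⟨C, hC, hgC⟩ := hg.growth
  have hint := (integrable_mul_min hN hVK hq₁ hq₂ hS hu hv).const_mul C
  have hKm := aestronglyMeasurable_radial hN hVK.K_cont
  have hcont : Continuous fun s => primG g (changeVar s) :=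
    continuous_iff_continuousAt.2 fun s => (hasDerivAt_primG_comp hg.cont s).continuousAt
  refine hasDerivAt_integral_weight (P := fun s => primG g (changeVar s))
    (P' := fun s => g (changeVar s) / invDeriv s) hKm hu.1.1.1 hv.1.1.1
    (hasDerivAt_primG_comp hg.cont) ((hg.cont.comp continuous_changeVar).div₀
      continuous_invDeriv fun s => (invDeriv_pos s).ne') ?_ hint ?_
  · refine hint.mono' (hKm.mul (hcont.comp_aestronglyMeasurable hu.1.1.1)) ?_
    filter_upwards [ae_norm_pos hN] with x hx
    have hK := (hVK.K_pos _ hx).le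
    rw [norm_mul, Real.norm_of_nonneg hK, mul_left_comm]
    have hle : |changeVar (u x)| ≤ |u x| + |v x| :=
      (abs_changeVar_le _).trans (le_add_of_nonneg_right (abs_nonneg _))
    exact mul_le_mul_of_nonneg_left
      ((abs_primG_le hg _).trans (abs_mul_le_of_growth hq₁ hq₂ hC.le hgC hle hle)) hK
  · filter_upwards [ae_norm_pos hN] with x hx t ht
    have hK := (hVK.K_pos _ hx).le
    have ht1 : |t| ≤ 1 := by
      have : |t| < 1 := by simpa using ht
      exact this.le
    rw [norm_mul, Real.norm_of_nonneg hK, norm_mul, mul_left_comm C]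
    refine mul_le_mul_of_nonneg_left ?_ hK
    have h3 : |t * v x| ≤ |v x| := by
      rw [abs_mul]; exact mul_le_of_le_one_left (abs_nonneg _) ht1
    refine (mul_le_mul_of_nonneg_right (abs_changeVar_div_le _ _) (abs_nonneg _)).trans
      (abs_mul_le_of_growth hq₁ hq₂ hC.le hgC ?_ (le_add_of_nonneg_left (abs_nonneg _)))
    exact (abs_changeVar_le _).trans ((abs_add_le _ _).trans (add_le_add le_rfl h3))

theorem integrable_inner_of_memLp {F α : Type*} [NormedAddCommGroup F] [InnerProductSpace ℝ F]
    [MeasurableSpace α] {μ : Measure α} {G H : α → F} (hG : MemLp G 2 μ) (hH : MemLp H 2 μ) :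
    Integrable (fun x => (inner ℝ (G x) (H x) : ℝ)) μ := by
  refine ((hG.integrable_norm_pow two_ne_zero).add (hH.integrable_norm_pow two_ne_zero)).mono'
    (hG.1.inner hH.1) (Eventually.of_forall fun x => ?_)
  have := norm_inner_le_norm (𝕜 := ℝ) (G x) (H x)
  simp only [Pi.add_apply]
  nlinarith [sq_nonneg (‖G x‖ - ‖H x‖), sq_nonneg (‖G x‖), sq_nonneg (‖H x‖)]

/-- By linearity and uniqueness of weak gradients the function is a quadratic polynomial in `t`. -/
theorem hasDerivAt_integral_weakGradient {u v : EuclideanSpace ℝ (Fin N) → ℝ}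
    {G H : EuclideanSpace ℝ (Fin N) → EuclideanSpace ℝ (Fin N)} (hu : HasRadialGradient u G)
    (hv : HasRadialGradient v H) :
    HasDerivAt (fun t : ℝ => ∫ x, ‖weakGradient (fun x => u x + t * v x) x‖ ^ 2)
      (2 * ∫ x, inner ℝ (G x) (H x)) 0 := by
  have hG := hu.2.2.1
  have hH := hv.2.2.1
  have hGi := hG.integrable_norm_pow two_ne_zero
  have hHi := hH.integrable_norm_pow two_ne_zero
  have hGH := integrable_inner_of_memLp hG hH
  have e : (fun t : ℝ => ∫ x, ‖weakGradient (fun x => u x + t * v x) x‖ ^ 2) = fun t =>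
      (∫ x, ‖G x‖ ^ 2) + t * (2 * ∫ x, inner ℝ (G x) (H x)) + t ^ 2 * ∫ x, ‖H x‖ ^ 2 := by
    funext t
    have hsum : Integrable (fun x => ‖G x‖ ^ 2 + t * (2 * inner ℝ (G x) (H x))) volume :=
      hGi.add ((hGH.const_mul 2).const_mul t)
    rw [← integral_const_mul, ← integral_const_mul, ← integral_const_mul,
      ← integral_add hGi ((hGH.const_mul 2).const_mul t),
      ← integral_add hsum (hHi.const_mul (t ^ 2))]
    refine integral_congr_ae ?_
    filter_upwards [(hu.2.1.add_const_mul hv.2.1 t).weakGradient_ae_eq] with x hx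
    rw [hx, norm_add_sq_real, norm_smul, mul_pow, Real.norm_eq_abs, sq_abs, real_inner_smul_right]
    ring
  rw [e]
  have h1 := (((hasDerivAt_id (0 : ℝ)).mul_const (2 * ∫ x, inner ℝ (G x) (H x))).const_add
    (∫ x, ‖G x‖ ^ 2)).add (((hasDerivAt_id (0 : ℝ)).pow 2).mul_const (∫ x, ‖H x‖ ^ 2))
  exact h1.congr_deriv (by simp)

/-- Since `‖t v‖ = t ‖v‖` for `t > 0`, criticality bounds the right difference quotients by `ε ‖v‖`
for every `ε`. A one-sided slope is enough because the derivative is assumed to exist. -/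
theorem IsCriticalPoint.hasDerivAt_energy_eq_zero (hN : 3 ≤ N) {V K g : ℝ → ℝ}
    (hVK : HypH V K) {u v : EuclideanSpace ℝ (Fin N) → ℝ} (hu : IsCriticalPoint V K g u)
    (hv : MemE V v) {D : ℝ} (hD : HasDerivAt (fun t => energy V K g (fun x => u x + t * v x)) D 0) :
    D = 0 := by
  obtain ⟨H, hH⟩ := memD_iff.1 hv.1
  set n := normE V v with hn
  have hn0 : 0 ≤ n := normE_nonneg hN hVK.V_nonneg v
  have hslope : Tendsto (fun t => t⁻¹ * (energy V K g (fun x => u x + t * v x) - energy V K g u))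
      (𝓝[>] 0) (𝓝 D) := by
    have := (hasDerivAt_iff_tendsto_slope_zero.1 hD).mono_left
      (nhdsWithin_mono 0 (show Set.Ioi (0 : ℝ) ⊆ {0}ᶜ from fun t ht => ne_of_gt ht))
    have e : (fun x => u x + 0 * v x) = u := by simp
    simpa only [zero_add, smul_eq_mul, e] using this
  have hle : ∀ ε, 0 < ε → |D| ≤ ε * n := by
    intro ε hε
    obtain ⟨δ, hδ, hcrit⟩ := hu.2 ε hε
    refine le_of_tendsto hslope.abs ?_
    -- The denominator `n + 1` keeps the interval nonempty when `n = 0`.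
    filter_upwards [Ioo_mem_nhdsGT (show (0 : ℝ) < δ / (n + 1) by positivity)] with t ht
    have ht0 : 0 < t := ht.1
    have e := hH.normE_const_mul hN V ht0
    have hsmall : normE V (fun x => t * v x) ≤ δ := by
      rw [e, ← hn]
      have := ht.2
      rw [lt_div_iff₀ (by positivity)] at this
      nlinarith
    have h1 := hcrit _ (hv.const_mul hN hVK.V_cont hVK.V_nonneg ht0) hsmall
    rw [e, ← hn] at h1
    rw [abs_mul, abs_inv, abs_of_pos ht0, inv_mul_le_iff₀ ht0]
    linarith
  have h0 : |D| ≤ 0 := by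
    refine le_of_forall_pos_le_add fun η hη => ?_
    have h1 := hle (η / (n + 1)) (by positivity)
    have h2 : η / (n + 1) * n ≤ η := by
      rw [div_mul_eq_mul_div, div_le_iff₀ (by positivity)]
      nlinarith
    linarith
  exact abs_eq_zero.1 (le_antisymm h0 (abs_nonneg _))

/-- The Euler equation of the functional in the direction `v`. -/
theorem IsCriticalPoint.euler (hN : 3 ≤ N) {V K g : ℝ → ℝ} {q₁ q₂ : ℝ}
    (hq₁ : 1 < q₁) (hq₂ : 1 < q₂) (hVK : HypH V K) (hg : HypG g q₁ q₂) (hS : HypS N V K q₁ q₂)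
    {u v : EuclideanSpace ℝ (Fin N) → ℝ}
    {G H : EuclideanSpace ℝ (Fin N) → EuclideanSpace ℝ (Fin N)} (hu : IsCriticalPoint V K g u)
    (huG : HasRadialGradient u G) (hv : MemE V v) (hvH : HasRadialGradient v H)
    (hv2 : Integrable (fun x => V ‖x‖ * v x ^ 2) volume) :
    (∫ x, inner ℝ (G x) (H x))
      + 1 / 2 * (∫ x, V ‖x‖ * (2 * changeVar (u x) / invDeriv (u x) * v x))
      - ∫ x, K ‖x‖ * (g (changeVar (u x)) / invDeriv (u x) * v x) = 0 := by
  have d1 := hasDerivAt_integral_weakGradient huG hvH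
  have d2 := (hasDerivAt_integral_potential hN hVK hu.1 hv hv2).2
  have d3 := (hasDerivAt_integral_nonlinearity hN hq₁ hq₂ hVK hg hS hu.1 hv).2
  have hd := ((d1.const_mul (1 / 2)).add (d2.const_mul (1 / 2))).sub d3
  rw [← hu.hasDerivAt_energy_eq_zero hN hVK hv hd]
  ring

end Derivative

end QuasilinearSchrodinger

end

/-! ### The weak equation for `w` -/

open QuasilinearSchrodinger in
theorem theorem6p4 (N : ℕ) (hN : 3 ≤ N) (V K g : ℝ → ℝ) (q₁ q₂ : ℝ)
    (hq₁ : 1 < q₁) (hq₂ : 1 < q₂)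
    (hVK : QuasilinearSchrodinger.HypH V K)
    (hg : QuasilinearSchrodinger.HypG g q₁ q₂)
    (hS : QuasilinearSchrodinger.HypS N V K q₁ q₂)
    (u w : EuclideanSpace ℝ (Fin N) → ℝ)
    (hu : QuasilinearSchrodinger.IsCriticalPoint V K g u)
    (hw : w = fun x => QuasilinearSchrodinger.changeVar (u x)) :
    QuasilinearSchrodinger.MemX V w ∧
    ∀ h : EuclideanSpace ℝ (Fin N) → ℝ, QuasilinearSchrodinger.IsRadialTest h →
      Integrable (fun x => (1 + 2 * w x ^ 2) *
        inner ℝ (QuasilinearSchrodinger.weakGradient w x) (gradient h x)) volume ∧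
      Integrable (fun x =>
        2 * w x * ‖QuasilinearSchrodinger.weakGradient w x‖ ^ 2 * h x) volume ∧
      Integrable (fun x => V ‖x‖ * w x * h x) volume ∧
      Integrable (fun x => K ‖x‖ * g (w x) * h x) volume ∧
      (∫ x, (1 + 2 * w x ^ 2) *
          inner ℝ (QuasilinearSchrodinger.weakGradient w x) (gradient h x))
        + (∫ x, 2 * w x * ‖QuasilinearSchrodinger.weakGradient w x‖ ^ 2 * h x)
        + (∫ x, V ‖x‖ * w x * h x)
        = ∫ x, K ‖x‖ * g (w x) * h x := by
  obtain ⟨G, hG⟩ := memD_iff.1 hu.1.1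
  have hwG := hG.changeVar_comp hN
  rw [← hw] at hwG
  refine ⟨⟨memD_iff.2 ⟨_, hwG⟩, by rw [hw]; exact hu.1.2⟩, fun h hh => ?_⟩
  have hv := hu.1.mul_invDeriv hN hVK hh
  have hvH := hG.mul_invDeriv hN hh
  have hv2 := hu.1.integrable_potential_mul_sq hN hVK hh
  have hgw := hwG.2.1.weakGradient_ae_eq
  have heuler := hu.euler hN hq₁ hq₂ hVK hg hS hG hv hvH hv2
  have iV := (hasDerivAt_integral_potential hN hVK hu.1 hv hv2).1
  have iK := (hasDerivAt_integral_nonlinearity hN hq₁ hq₂ hVK hg hS hu.1 hv).1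
  have hΨ : ∀ x, invDeriv (u x) ≠ 0 := fun x => (invDeriv_pos _).ne'
  have eV : (fun x => V ‖x‖ * (2 * changeVar (u x) / invDeriv (u x) * (h x * invDeriv (u x))))
      = fun x => 2 * (V ‖x‖ * w x * h x) := by
    funext x
    have := hΨ x
    rw [hw]
    field_simp
  have eK : (fun x => K ‖x‖ * (g (changeVar (u x)) / invDeriv (u x) * (h x * invDeriv (u x))))
      = fun x => K ‖x‖ * g (w x) * h x := by
    funext x
    have := hΨ x
    rw [hw]
    field_simp
  obtain ⟨A, hA⟩ := hh.1.1.continuous.bounded_above_of_compact_support hh.1.2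
  have hA0 : 0 ≤ A := (norm_nonneg _).trans (hA 0)
  -- In terms of `u` the quadratic gradient term has the bounded coefficient `2f / (1 + 2f²)`, so it
  -- is integrable even though `w` may be unbounded.
  have iQ : Integrable (fun x => h x * (2 * changeVar (u x) / invDeriv (u x) ^ 2) * ‖G x‖ ^ 2)
      volume := by
    have hc : Continuous fun s => 2 * changeVar s / invDeriv s ^ 2 :=
      (continuous_changeVar.const_mul 2).div₀ (continuous_invDeriv.pow 2)
        fun s => (pow_pos (invDeriv_pos s) 2).ne'
    refine (hG.2.2.1.integrable_norm_pow two_ne_zero).bdd_mul (c := A * 1)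
      (hh.1.1.continuous.aestronglyMeasurable.mul (hc.comp_aestronglyMeasurable hG.1.1))
      (Eventually.of_forall fun x => ?_)
    rw [norm_mul]
    exact mul_le_mul (hA x) (abs_two_mul_changeVar_div_le _) (abs_nonneg _) hA0
  have eQ : (fun x => h x * (2 * changeVar (u x) / invDeriv (u x) ^ 2) * ‖G x‖ ^ 2) =ᵐ[volume]
      fun x => 2 * w x * ‖weakGradient w x‖ ^ 2 * h x := by
    filter_upwards [hgw] with x hx
    rw [hx, hw, norm_smul, mul_pow, Real.norm_eq_abs, sq_abs, div_pow]
    ring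
  -- Substituting `∇u = √(1 + 2w²) ∇w`, the first integrand is `∇u · ∇v` minus the quadratic term,
  -- and inherits its integrability from these two.
  have eI : (fun x => (inner ℝ (G x) (invDeriv (u x) • gradient h x
      + (h x * (2 * changeVar (u x) / invDeriv (u x) ^ 2)) • G x) : ℝ)
      - h x * (2 * changeVar (u x) / invDeriv (u x) ^ 2) * ‖G x‖ ^ 2) =ᵐ[volume]
      fun x => (1 + 2 * w x ^ 2) * inner ℝ (weakGradient w x) (gradient h x) := by
    filter_upwards [hgw] with x hx
    have := hΨ x
    rw [hx, hw, inner_add_right, real_inner_smul_right, real_inner_smul_right,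
      real_inner_self_eq_norm_sq, real_inner_smul_left, ← invDeriv_sq]
    field_simp
    ring
  have iI := integrable_inner_of_memLp hG.2.2.1 hvH.2.2.1
  rw [eV] at iV heuler
  rw [eK] at iK heuler
  have iV' : Integrable (fun x => V ‖x‖ * w x * h x) volume := by
    simpa using iV.const_mul (1 / 2)
  refine ⟨(iI.sub iQ).congr eI, iQ.congr eQ, iV', iK, ?_⟩
  rw [← integral_congr_ae eI, ← integral_congr_ae eQ, integral_sub iI iQ]
  rw [integral_const_mul] at heuler
  linarith
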